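/- **Setting.** A colored hexagon is a hexagon with three pairwise non-adjacent sides colored red and the other three colored black. Let $(S,T)$ be an ideally triangulated surface: $S$ is obtained from a finite non-empty disjoint union of colored hexagons by identifying all red sides in pairs by homeomorphisms (two red sides of the same hexagon may be identified). The images of the red sides are the edges; $E$ is the set of edges. The images of the black sides are called A-arcs. By straightening the edges to shortest geodesic arcs orthogonal to the boundary, a hyperbolic metric on $S$ with totally geodesic boundary, up to isotopy, is the same as a realization of every 2-cell as a hyperbolic right-angled hexagon in which identified red sides have equal lengths, up to isometries carrying every labelled 2-cell to itself; the Teichmüller space $T(S)$ is the space of these. For $\lambda\in\mathbf R$ and a metric in $T(S)$, the $\psi_\lambda$ edge invariant is $$\psi_\lambda(e)=\int_0^{\frac{a+b-c}{2}}\cosh^\lambda(t)\,dt+\int_0^{\frac{a'+b'-c'}{2}}\cosh^\lambda(t)\,dt ,$$ where for each of the two red sides forming $e$, $a,b$ (resp. $a',b'$) are the lengths of the two A-arcs adjacent to that side in its hexagon and $c$ (resp. $c'$) is the length of the A-arc facing it. This defines $\Psi_\lambda:T(S)\to\mathbf R^E$. An edge path $(H_0,e_1,H_1,\dots,e_n,H_n)$,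 $n\ge 1$, is a sequence of hexagons and edges in which one passes from $H_{i-1}$ to $H_i$ across $e_i$, such that for $1\le i<n$ the path enters $H_i$ through one red side (lying over $e_i$) and leaves it through a different red side (lying over $e_{i+1}$). It is an edge cycle if $H_n=H_0$ and the red side of $H_0$ through which it finally enters (over $e_n$) differs from the one through which it first leaves (over $e_1$). An edge path or cycle is fundamental if every edge occurs at most twice among $e_1,\dots,e_n$. **Theorem.** Let $(S,T)$ be an ideally triangulated surface. For every $\lambda\in\mathbf R$, the image $\Psi_\lambda(T(S))$ is the set of all $z\in\mathbf R^E$ such that 1. $z(e)<2\int_0^\infty\cosh^\lambda(t)\,dt$ for each edge $e$; 2. $\sum_{i=1}^n z(e_i)>-2\int_0^\infty\cosh^\lambda(t)\,dt$ for each fundamental edge path $(H_0,e_1,H_1,\dots,e_n,H_n)$; 3. $\sum_{i=1}^n z(e_i)>0$ for each fundamental edge cycle $(H_0,e_1,H_1,\dots,e_n,H_n=H_0)$ (the integral is $+\infty$ when $\lambda\ge 0$). Consequently $\Psi_\lambda(T(S))$ is an open convex polytope, that is, an open convex set cut out by finitely many strict affine inequalities. Moreover, for $\lambda_1<\lambda_2<0<\lambda_3$,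 $$\Psi_{\lambda_1}(T(S))\subsetneq\Psi_{\lambda_2}(T(S))\subsetneq\Psi_0(T(S))=\Psi_{\lambda_3}(T(S)),$$ and $\bigcap_{\lambda<0}\Psi_\lambda(T(S))=\emptyset$. -/

import Mathlib

open scoped UpperHalfPlane ENNReal

noncomputable section

namespace LuoCoord

/-! ### Right-angled hexagons in the hyperbolic plane -/

/-- The image of `w` under the isometry `w ↦ (w - z) / (w - z̄)` from the upper half-plane onto the
Poincaré disk that sends `z` to the origin. Geodesics through the origin are diameters, so the
argument of this number is the direction at `z` of the geodesic from `z` to `w`. -/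
def direction (z w : ℍ) : ℂ := ((w : ℂ) - (z : ℂ)) / ((w : ℂ) - (starRingEnd ℂ) (z : ℂ))

/-- The oriented hyperbolic angle at `z`, in `(-π, π]`, counterclockwise from the geodesic ray
towards `u` to the geodesic ray towards `w`. -/
def orientedAngle (z u w : ℍ) : ℝ := (direction z w / direction z u).arg

/-- A colored hyperbolic right-angled hexagon, with vertices
`p 0, q 0, p 1, q 1, p 2, q 2` in counterclockwise order. The red sides are `[p i, q i]`, the black
sides (A-arcs) are `[q i, p (i + 1)]` (indices modulo 3), and all six interior angles are `π / 2`.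
(Adjacent vertices are automatically distinct, since `Complex.arg 0 = 0`.) -/
structure RightAngledHexagon where
  /-- the initial vertex of each red side -/
  p : Fin 3 → ℍ
  /-- the terminal vertex of each red side -/
  q : Fin 3 → ℍ
  angle_p : ∀ i, orientedAngle (p i) (q i) (q (i + 2)) = Real.pi / 2
  angle_q : ∀ i, orientedAngle (q i) (p (i + 1)) (p i) = Real.pi / 2

namespace RightAngledHexagon

/-- The length of the `i`-th red side. -/
def redLength (H : RightAngledHexagon) (i : Fin 3) : ℝ := dist (H.p i) (H.q i)

/-- The length of the A-arc facing the `i`-th red side, that is, of the A-arc which joins the two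
other red sides. -/
def arcLength (H : RightAngledHexagon) (i : Fin 3) : ℝ := dist (H.q (i + 1)) (H.p (i + 2))

/-- Half of `a + b - c`, where `a`, `b` are the lengths of the two A-arcs adjacent to the `i`-th red
side and `c` is the length of the A-arc facing it. -/
def rCoord (H : RightAngledHexagon) (i : Fin 3) : ℝ :=
  (H.arcLength (i + 1) + H.arcLength (i + 2) - H.arcLength i) / 2

/-- Congruence of colored right-angled hexagons with labelled sides: some isometry of the hyperbolic
plane carries each vertex to the corresponding vertex. -/
def Congruent (H K : RightAngledHexagon) : Prop :=
  ∃ g : ℍ ≃ᵢ ℍ, ∀ i, g (H.p i) = K.p i ∧ g (H.q i) = K.q i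

theorem Congruent.refl (H : RightAngledHexagon) : H.Congruent H :=
  ⟨IsometryEquiv.refl ℍ, fun _ => ⟨rfl, rfl⟩⟩

theorem Congruent.symm {H K : RightAngledHexagon} (h : H.Congruent K) : K.Congruent H := by
  obtain ⟨g, hg⟩ := h
  refine ⟨g.symm, fun i => ?_⟩
  rw [← (hg i).1, ← (hg i).2]
  simp

theorem Congruent.trans {H K L : RightAngledHexagon} (h : H.Congruent K) (h' : K.Congruent L) :
    H.Congruent L := by
  obtain ⟨g, hg⟩ := h
  obtain ⟨g', hg'⟩ := h'
  refine ⟨g.trans g', fun i => ?_⟩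
  simp [(hg i).1, (hg i).2, (hg' i).1, (hg' i).2]

theorem Congruent.arcLength_eq {H K : RightAngledHexagon} (h : H.Congruent K) (i : Fin 3) :
    H.arcLength i = K.arcLength i := by
  obtain ⟨g, hg⟩ := h
  simp only [arcLength, ← (hg _).1, ← (hg _).2, g.dist_eq]

theorem Congruent.rCoord_eq {H K : RightAngledHexagon} (h : H.Congruent K) (i : Fin 3) :
    H.rCoord i = K.rCoord i := by
  simp only [rCoord, h.arcLength_eq]

end RightAngledHexagon

/-! ### Ideally triangulated surfaces -/

/-- An ideally triangulated compact surface with boundary: a disjoint union of colored hexagons,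
indexed by `ι`, whose red sides are identified in pairs. The pair `(h, i) : ι × Fin 3` is the `i`-th
red side of the hexagon `h`; the red sides of a hexagon are numbered in cyclic order. Two red sides
of one and the same hexagon may be identified with each other. Up to isotopy an identification is
given by the pairing and by whether it preserves the directions `p → q` of the two sides; both
kinds are allowed, so the surface need not be orientable. -/
structure IdealTriangulation (ι : Type*) where
  /-- the red side with which a red side is identified -/
  glue : ι × Fin 3 → ι × Fin 3
  glue_glue : ∀ s, glue (glue s) = s
  glue_ne : ∀ s, glue s ≠ s
  /-- whether the identification preserves the directions of the two sides -/
  preserves : ι × Fin 3 → Bool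
  preserves_glue : ∀ s, preserves (glue s) = preserves s

namespace IdealTriangulation

variable {ι : Type*} (T : IdealTriangulation ι)

/-- Two red sides have the same image in the surface. -/
def sideSetoid : Setoid (ι × Fin 3) where
  r s t := t = s ∨ t = T.glue s
  iseqv :=
    { refl := fun _ => Or.inl rfl
      symm := by
        rintro s t (rfl | rfl)
        · exact Or.inl rfl
        · exact Or.inr (T.glue_glue s).symm
      trans := by
        rintro s t u (rfl | rfl) (rfl | rfl)
        · exact Or.inl rfl
        · exact Or.inr rfl
        · exact Or.inr rfl
        · exact Or.inl (T.glue_glue s) }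

/-- The edges of the ideal triangulation: the images of the red sides in the surface. -/
def Edge : Type _ := Quotient T.sideSetoid

/-- The edge that is the image of a red side. -/
def edge (s : ι × Fin 3) : T.Edge := Quotient.mk T.sideSetoid s

/-- A hyperbolic metric with totally geodesic boundary on the triangulated surface: every 2-cell is
a colored hyperbolic right-angled hexagon, and red sides that are identified have equal lengths, so
that they can be glued isometrically. -/
structure HyperbolicMetric where
  hexagon : ι → RightAngledHexagon
  redLength_glue : ∀ s : ι × Fin 3,
    (hexagon (T.glue s).1).redLength (T.glue s).2 = (hexagon s.1).redLength s.2

/-- Two hyperbolic metrics are equivalent if there is an isometry between them that carries every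
labelled 2-cell to itself. -/
def metricSetoid : Setoid T.HyperbolicMetric where
  r d d' := ∀ h, (d.hexagon h).Congruent (d'.hexagon h)
  iseqv :=
    { refl := fun _ _ => RightAngledHexagon.Congruent.refl _
      symm := fun H h => (H h).symm
      trans := fun H H' h => (H h).trans (H' h) }

/-- The Teichmüller space of the triangulated surface. -/
def Teichmuller : Type _ := Quotient T.metricSetoid

/-- The contribution `∫₀^{(a+b-c)/2} cosh^lam t dt` of one red side to the edge invariant. -/
def sideInvariant (lam : ℝ) (d : T.HyperbolicMetric) (s : ι × Fin 3) : ℝ :=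
  ∫ t in (0 : ℝ)..(d.hexagon s.1).rCoord s.2, Real.cosh t ^ lam

/-- The `ψ_lam` edge invariant of a hyperbolic metric: the sum of the contributions of the two red
sides that are identified to the edge. -/
def edgeInvariant (lam : ℝ) (d : T.HyperbolicMetric) : T.Edge → ℝ :=
  Quotient.lift (fun s => T.sideInvariant lam d s + T.sideInvariant lam d (T.glue s)) (by
    rintro s t (rfl | rfl)
    · rfl
    · simp only [T.glue_glue]
      exact add_comm _ _)

/-- The map `Ψ_lam` from the Teichmüller space to `ℝ^E`. -/
def Psi (lam : ℝ) : T.Teichmuller → (T.Edge → ℝ) :=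
  Quotient.lift (T.edgeInvariant lam) (by
    intro d d' h
    funext e
    refine Quotient.inductionOn e fun s => ?_
    simp only [edgeInvariant, sideInvariant, Quotient.lift_mk, (h _).rCoord_eq])

/-! ### Edge paths and edge cycles -/

/-- A red side `s` also stands for a crossing of its edge: one leaves the hexagon `s.1` through `s`
and enters the hexagon `(T.glue s).1` through `T.glue s`. The crossing `t` may follow the crossing
`s` if `t` leaves the hexagon entered by `s`, through a red side other than the one through which
`s` entered. -/
def Follows (s t : ι × Fin 3) : Prop := t.1 = (T.glue s).1 ∧ t ≠ T.glue s

/-- An edge path `(H₀, e₁, H₁, …, eₙ, Hₙ)` with `n ≥ 1`, given by its crossings. -/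
def IsEdgePath (c : List (ι × Fin 3)) : Prop := c ≠ [] ∧ c.IsChain T.Follows

/-- An edge cycle `(H₀, e₁, H₁, …, eₙ, Hₙ = H₀)` with `n ≥ 1`: an edge path whose first crossing
may follow its last one. -/
def IsEdgeCycle (c : List (ι × Fin 3)) : Prop :=
  T.IsEdgePath c ∧ ∃ h : c ≠ [], T.Follows (c.getLast h) (c.head h)

open Classical in
/-- Each edge appears at most twice. -/
def IsFundamental (c : List (ι × Fin 3)) : Prop := ∀ e : T.Edge, (c.map T.edge).count e ≤ 2

/-- The sum of `z (eᵢ)` over the edges of an edge path. -/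
def pathSum (z : T.Edge → ℝ) (c : List (ι × Fin 3)) : ℝ := (c.map fun s => z (T.edge s)).sum

end IdealTriangulation

/-! ### The polytope -/

/-- `∫₀^∞ cosh^lam t dt`, which is infinite for `lam ≥ 0`. -/
def coshIntegral (lam : ℝ) : ℝ≥0∞ := ∫⁻ t in Set.Ioi (0 : ℝ), ENNReal.ofReal (Real.cosh t ^ lam)

/-- An open convex polytope in `ℝ^E`, not necessarily bounded: an open convex set that is cut out by
finitely many strict affine inequalities. -/
def IsOpenConvexPolytope {E : Type*} (P : Set (E → ℝ)) : Prop :=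
  IsOpen P ∧ Convex ℝ P ∧
    ∃ A : Set (((E → ℝ) →ₗ[ℝ] ℝ) × ℝ), A.Finite ∧ P = {z | ∀ a ∈ A, a.1 z < a.2}

end LuoCoord

end

/-!
A right-angled hexagon is determined by the coordinates `r` of its red sides, half the difference
between the lengths of the two adjacent A-arcs and that of the facing one, subject only to pairwise
sums being positive; applying the primitive of `cosh ^ lam` to them turns `Psi` into the sum of
the *weights* of the two sides forming an edge. Weights with prescribed edge sums are the solutions
of a system of strict difference constraints, solvable exactly when the sums along fundamental edge
paths and cycles satisfy the stated inequalities. Among these weights the metric is singled out as a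
critical point of a potential whose derivative along a red side is an increasing function of the
length of that side: at an interior maximum of the potential on the set of weights with given edge
sums, glued sides have equal lengths. The maximum is interior because the slope of the potential is
infinite at the boundary.
-/

noncomputable section

namespace LuoCoord

section Frames

open UpperHalfPlane (I)
open scoped MatrixGroups Real

/-! ### Frames along a right-angled hexagon -/

section Moebius

variable {K : Type*} [Field K]

theorem moebius_sub_moebius {a b c d u v : K} (hdet : a * d - b * c = 1) (hu : c * u + d ≠ 0)
    (hv : c * v + d ≠ 0) : (a * u + b) / (c * u + d) - (a * v + b) / (c * v + d) =
      (u - v) / ((c * u + d) * (c * v + d)) := by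
  rw [div_sub_div _ _ hu hv]
  congr 1
  linear_combination (u - v) * hdet

end Moebius

theorem coe_sub_conj_ne_zero (z w : ℍ) : (w : ℂ) - (starRingEnd ℂ) (z : ℂ) ≠ 0 := fun h => by
  have him := congrArg Complex.im h
  simp only [Complex.sub_im, Complex.conj_im, sub_neg_eq_add, Complex.zero_im] at him
  exact (add_pos w.im_pos z.im_pos).ne' him

section Cocycle

variable (g : SL(2, ℝ)) (z : ℍ)

theorem moebius_denom_ne_zero : (g 1 0 : ℂ) * z + g 1 1 ≠ 0 := by
  simpa [UpperHalfPlane.denom] using UpperHalfPlane.denom_ne_zero (g : GL (Fin 2) ℝ) z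

theorem moebius_denom_conj_ne_zero : (g 1 0 : ℂ) * (starRingEnd ℂ) (z : ℂ) + g 1 1 ≠ 0 := by
  simpa using (map_ne_zero (starRingEnd ℂ)).2 (moebius_denom_ne_zero g z)

theorem direction_smul (w : ℍ) : direction (g • z) (g • w) = direction z w *
    ((g 1 0 * (starRingEnd ℂ) (z : ℂ) + g 1 1) / (g 1 0 * (z : ℂ) + g 1 1)) := by
  have hdet : (g 0 0 : ℂ) * g 1 1 - g 0 1 * g 1 0 = 1 := by
    exact_mod_cast (Matrix.det_fin_two (g : Matrix (Fin 2) (Fin 2) ℝ)).symm.trans g.det_coe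
  have hcoe (v : ℍ) : ((g • v : ℍ) : ℂ) = (g 0 0 * (v : ℂ) + g 0 1) / (g 1 0 * (v : ℂ) + g 1 1) :=
    by simpa using UpperHalfPlane.coe_specialLinearGroup_apply g v
  have hconj : (starRingEnd ℂ) ((g • z : ℍ) : ℂ) =
      (g 0 0 * (starRingEnd ℂ) (z : ℂ) + g 0 1) / (g 1 0 * (starRingEnd ℂ) (z : ℂ) + g 1 1) := by
    simp only [hcoe, map_div₀, map_add, map_mul, Complex.conj_ofReal]
  have hz := moebius_denom_ne_zero g z
  have hz' := moebius_denom_conj_ne_zero g z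
  have hw := moebius_denom_ne_zero g w
  have hwz := coe_sub_conj_ne_zero z w
  rw [direction, direction, hconj, hcoe, hcoe, moebius_sub_moebius hdet hw hz,
    moebius_sub_moebius hdet hw hz', div_div_div_eq, div_mul_div_comm,
    div_eq_div_iff (mul_ne_zero (mul_ne_zero hw hz) hwz) (mul_ne_zero hwz hz)]
  ring

theorem orientedAngle_smul (u w : ℍ) :
    orientedAngle (g • z) (g • u) (g • w) = orientedAngle z u w := by
  rw [orientedAngle, direction_smul, direction_smul, mul_div_mul_right _ _
    (div_ne_zero (moebius_denom_conj_ne_zero g z) (moebius_denom_ne_zero g z)), orientedAngle]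

end Cocycle

/-- The hyperbolic translation by `a` along the imaginary axis; it moves `I` to `exp a * I`. -/
def axisTranslation (a : ℝ) : SL(2, ℝ) :=
  ⟨!![Real.exp (a / 2), 0; 0, Real.exp (-(a / 2))], by
    rw [Matrix.det_fin_two_of, ← Real.exp_add, add_neg_cancel, Real.exp_zero, mul_zero, sub_zero]⟩

/-- The counterclockwise rotation by `π / 2` around the point `I` of the upper half-plane. -/
def quarterTurn : SL(2, ℝ) :=
  ⟨!![√2 / 2, √2 / 2; -(√2 / 2), √2 / 2], by
    rw [Matrix.det_fin_two_of]
    linear_combination Real.mul_self_sqrt (zero_le_two (α := ℝ)) / 2⟩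

theorem axisTranslation_neg (a : ℝ) : axisTranslation (-a) = (axisTranslation a)⁻¹ := by
  apply Subtype.ext
  rw [Matrix.SpecialLinearGroup.coe_inv]
  simp [axisTranslation, Matrix.adjugate_fin_two_of, neg_div]

theorem coe_axisTranslation_smul_I (a : ℝ) :
    ((axisTranslation a • I : ℍ) : ℂ) = Real.exp a * Complex.I := by
  have hexp : Real.exp a = Real.exp (a / 2) / Real.exp (-(a / 2)) := by
    rw [← Real.exp_sub]
    ring_nf
  rw [UpperHalfPlane.coe_specialLinearGroup_apply, hexp]
  simp only [axisTranslation, Matrix.of_apply, Matrix.cons_val, Algebra.algebraMap_self,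
    RingHom.id_apply, UpperHalfPlane.coe_I, Complex.ofReal_zero, Complex.ofReal_div]
  ring

theorem dist_I_axisTranslation_smul_I (a : ℝ) : dist I (axisTranslation a • I) = |a| := by
  have hcoe := coe_axisTranslation_smul_I a
  have hre : (axisTranslation a • I : ℍ).re = 0 := by
    rw [← UpperHalfPlane.coe_re, hcoe, Complex.re_ofReal_mul, Complex.I_re, mul_zero]
  have him : (axisTranslation a • I : ℍ).im = Real.exp a := by
    rw [← UpperHalfPlane.coe_im, hcoe, Complex.im_ofReal_mul, Complex.I_im, mul_one]
  rw [UpperHalfPlane.dist_of_re_eq (UpperHalfPlane.I_re.trans hre.symm), him, UpperHalfPlane.I_im,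
    Real.log_one, Real.log_exp, Real.dist_eq, zero_sub, abs_neg]

theorem direction_I_axisTranslation_smul_I (a : ℝ) :
    direction I (axisTranslation a • I) = Real.tanh (a / 2) := by
  have htanh : Real.tanh (a / 2) = (Real.exp a - 1) / (Real.exp a + 1) := by
    have hsq : Real.exp a = Real.exp (a / 2) * Real.exp (a / 2) := by
      rw [← Real.exp_add, add_halves]
    rw [Real.tanh_eq_sinh_div_cosh, Real.sinh_eq, Real.cosh_eq, Real.exp_neg, hsq]
    field_simp
  rw [direction, coe_axisTranslation_smul_I, htanh, UpperHalfPlane.coe_I, Complex.conj_I]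
  push_cast
  rw [sub_neg_eq_add, ← sub_one_mul, ← add_one_mul, mul_div_mul_right _ _ Complex.I_ne_zero]

theorem moebius_quarterTurn_I :
    ((√2 / 2 : ℂ) * Complex.I + √2 / 2) / (-(√2 / 2) * Complex.I + √2 / 2) = Complex.I := by
  have hI : 1 - Complex.I ≠ 0 := fun h => by simpa using congrArg Complex.re h
  have hden : -(√2 / 2 : ℂ) * Complex.I + √2 / 2 ≠ 0 := by
    have h2 : (√2 / 2 : ℂ) ≠ 0 := by norm_num
    convert mul_ne_zero h2 hI using 1
    ring
  rw [div_eq_iff hden]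
  linear_combination (√2 / 2 : ℂ) * Complex.I_mul_I

theorem quarterTurn_smul_I : quarterTurn • I = I := by
  apply UpperHalfPlane.ext
  rw [UpperHalfPlane.coe_specialLinearGroup_apply]
  simpa [quarterTurn] using moebius_quarterTurn_I

theorem direction_I_quarterTurn_smul (w : ℍ) :
    direction I (quarterTurn • w) = Complex.I * direction I w := by
  have hcocycle : ((quarterTurn 1 0 : ℂ) * (starRingEnd ℂ) (I : ℂ) + quarterTurn 1 1) /
      (quarterTurn 1 0 * (I : ℂ) + quarterTurn 1 1) = Complex.I := by
    simpa [quarterTurn] using moebius_quarterTurn_I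
  conv_lhs => rw [← quarterTurn_smul_I]
  rw [direction_smul, hcocycle, mul_comm]

theorem direction_I_quarterTurn_inv_smul (w : ℍ) :
    direction I (quarterTurn⁻¹ • w) = -Complex.I * direction I w := by
  have h := direction_I_quarterTurn_smul (quarterTurn⁻¹ • w)
  rw [smul_inv_smul] at h
  linear_combination Complex.I * h + direction I (quarterTurn⁻¹ • w) * Complex.I_mul_I

theorem tanh_half_pos {a : ℝ} (ha : 0 < a) : 0 < Real.tanh (a / 2) := by
  rw [Real.tanh_eq_sinh_div_cosh]
  exact div_pos (Real.sinh_pos_iff.2 (half_pos ha)) (Real.cosh_pos _)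

theorem arg_pos_mul_I {a : ℝ} (ha : 0 < a) : ((a : ℂ) * Complex.I).arg = π / 2 := by
  rw [Complex.arg_real_mul _ ha, Complex.arg_I]

theorem orientedAngle_I_axisTranslation_quarterTurn_inv {a b : ℝ} (ha : 0 < a) (hb : 0 < b) :
    orientedAngle I (axisTranslation a • I) (quarterTurn⁻¹ • axisTranslation (-b) • I) = π / 2 := by
  rw [← arg_pos_mul_I (div_pos (tanh_half_pos hb) (tanh_half_pos ha)), orientedAngle,
    direction_I_quarterTurn_inv_smul, direction_I_axisTranslation_smul_I,
    direction_I_axisTranslation_smul_I, neg_div, Real.tanh_neg]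
  push_cast
  ring_nf

theorem orientedAngle_I_quarterTurn_axisTranslation {a b : ℝ} (ha : 0 < a) (hb : 0 < b) :
    orientedAngle I (quarterTurn • axisTranslation b • I) (axisTranslation (-a) • I) = π / 2 := by
  rw [← arg_pos_mul_I (div_pos (tanh_half_pos ha) (tanh_half_pos hb)), orientedAngle,
    direction_I_quarterTurn_smul, direction_I_axisTranslation_smul_I,
    direction_I_axisTranslation_smul_I, neg_div, Real.tanh_neg, div_mul_eq_div_div_swap,
    Complex.div_I]
  push_cast
  ring_nf

/-- The change of frame from the initial vertex of a red side of length `x` to that of the next red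
side, where `θ` is the length of the A-arc between them. A frame `g : SL(2, ℝ)` has its base point
at `g • I`, and its first vector is the image of the upward direction. -/
def sideStep (x θ : ℝ) : SL(2, ℝ) :=
  axisTranslation x * quarterTurn * axisTranslation θ * quarterTurn

theorem fin_three_add_add (i : Fin 3) :
    i + 1 + 1 = i + 2 ∧ i + 1 + 2 = i ∧ i + 2 + 1 = i ∧ i + 2 + 2 = i + 1 := by
  fin_cases i <;> decide

@[to_additive]
theorem prod_fin_three {M : Type*} [CommMonoid M] (f : Fin 3 → M) (i : Fin 3) :
    ∏ j, f j = f i * f (i + 1) * f (i + 2) := by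
  rw [Fin.prod_univ_three]
  fin_cases i
  · rfl
  · exact (mul_assoc _ _ _).trans (mul_comm _ _)
  · exact (mul_comm _ _).trans (mul_assoc _ _ _).symm

section HexagonOfFrames

variable {x θ : Fin 3 → ℝ} (hx : ∀ i, 0 < x i) (hθ : ∀ i, 0 < θ i) (G : Fin 3 → SL(2, ℝ))
  (hG : ∀ i, ∀ z : ℍ, G (i + 1) • z = (G i * sideStep (x i) (θ (i + 2))) • z)

/-- The right-angled hexagon whose frames at the initial vertices of the red sides are `G`. The
frames only need to fit together as isometries, since the frame that returns after a full turn is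
the negative of the initial one. -/
def hexagonOfFrames : RightAngledHexagon where
  p i := G i • I
  q i := (G i * axisTranslation (x i)) • I
  angle_p i := by
    have hstep := hG (i + 2)
    rw [(fin_three_add_add i).2.2.1] at hstep
    have hprev : (G (i + 2) * axisTranslation (x (i + 2))) • I =
        G i • (quarterTurn⁻¹ • axisTranslation (-θ (i + 2 + 2)) • I) := by
      rw [hstep, axisTranslation_neg]
      conv_lhs => rw [← quarterTurn_smul_I]
      simp only [← mul_smul, sideStep]
      congr 1
      group
    rw [hprev, mul_smul, orientedAngle_smul]
    exact orientedAngle_I_axisTranslation_quarterTurn_inv (hx _) (hθ _)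
  angle_q i := by
    have hnext : G (i + 1) • I = (G i * axisTranslation (x i)) •
        (quarterTurn • axisTranslation (θ (i + 2)) • I) := by
      rw [hG]
      simp only [sideStep, mul_smul, quarterTurn_smul_I]
    have hprev : G i • I = (G i * axisTranslation (x i)) • axisTranslation (-x i) • I := by
      rw [axisTranslation_neg, mul_smul, smul_inv_smul]
    rw [hnext, hprev, orientedAngle_smul]
    exact orientedAngle_I_quarterTurn_axisTranslation (hx _) (hθ _)

theorem redLength_hexagonOfFrames (i : Fin 3) :
    (hexagonOfFrames hx hθ G hG).redLength i = x i := by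
  simp only [RightAngledHexagon.redLength, hexagonOfFrames, mul_smul, dist_smul,
    dist_I_axisTranslation_smul_I, abs_of_pos (hx i)]

theorem arcLength_hexagonOfFrames (i : Fin 3) :
    (hexagonOfFrames hx hθ G hG).arcLength i = θ i := by
  obtain ⟨h11, h12, -, -⟩ := fin_three_add_add i
  calc (hexagonOfFrames hx hθ G hG).arcLength i
      = dist (quarterTurn • I) (quarterTurn • axisTranslation (θ i) • I) := by
        simp only [RightAngledHexagon.arcLength, hexagonOfFrames]
        rw [← h11, hG, h12]
        simp only [sideStep, mul_smul, quarterTurn_smul_I, dist_smul]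
    _ = θ i := by rw [dist_smul, dist_I_axisTranslation_smul_I, abs_of_pos (hθ i)]

end HexagonOfFrames

/-! ### Existence of right-angled hexagons -/

theorem coe_sideStep (x θ : ℝ) : (sideStep x θ : Matrix (Fin 2) (Fin 2) ℝ) =
    !![Real.exp (x / 2) * Real.sinh (θ / 2), Real.exp (x / 2) * Real.cosh (θ / 2);
      -(Real.exp (-(x / 2)) * Real.cosh (θ / 2)), -(Real.exp (-(x / 2)) * Real.sinh (θ / 2))] := by
  have h2 := Real.mul_self_sqrt (zero_le_two (α := ℝ))
  simp only [sideStep, Matrix.SpecialLinearGroup.coe_mul]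
  simp only [axisTranslation, quarterTurn, Matrix.mul_fin_two, Real.sinh_eq, Real.cosh_eq]
  ext i j
  fin_cases i <;> fin_cases j <;>
    simp only [Fin.zero_eta, Fin.mk_one, Matrix.of_apply, Matrix.cons_val]
  · linear_combination (Real.exp (x / 2) * (Real.exp (θ / 2) - Real.exp (-(θ / 2))) / 4) * h2
  · linear_combination (Real.exp (x / 2) * (Real.exp (θ / 2) + Real.exp (-(θ / 2))) / 4) * h2
  · linear_combination (-Real.exp (-(x / 2)) * (Real.exp (θ / 2) + Real.exp (-(θ / 2))) / 4) * h2
  · linear_combination (-Real.exp (-(x / 2)) * (Real.exp (θ / 2) - Real.exp (-(θ / 2))) / 4) * h2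

section HyperbolicIdentities

variable (a b c : ℝ)

open Real

theorem cosh_mul_cosh_sub_cosh_mul_cosh :
    cosh (a + b + c) * cosh a - cosh b * cosh c = sinh (c + a) * sinh (a + b) := by
  simp only [cosh_add, sinh_add]
  linear_combination (cosh b * cosh c) * cosh_sq_sub_sinh_sq a

theorem cosh_mul_cosh_sub_cosh_mul_cosh_eq_sinh_mul_sinh :
    cosh (a + b + c) * cosh (c - a) - cosh (a + b - c) * cosh (c + a) = sinh b * sinh (2 * c) := by
  simp only [cosh_add, cosh_sub, sinh_add, sinh_two_mul]
  linear_combination (2 * sinh b * cosh c * sinh c) * cosh_sq_sub_sinh_sq a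

theorem cosh_mul_sinh_add_cosh_mul_sinh :
    cosh (a + b + c) * sinh (c - a) + cosh (a + b - c) * sinh (c + a) = cosh b * sinh (2 * c) := by
  simp only [cosh_add, cosh_sub, sinh_add, sinh_sub, sinh_two_mul]
  linear_combination (2 * cosh b * cosh c * sinh c) * cosh_sq_sub_sinh_sq a

end HyperbolicIdentities

theorem sideStep_mul_sideStep {a b c x₀ x₁ x₂ : ℝ} (hc : Real.sinh (2 * c) ≠ 0)
    (hcc : Real.sinh (2 * c) * (Real.cosh (x₀ / 2) * Real.cosh (x₁ / 2)) =
      Real.cosh (a + b + c) * Real.sinh (x₂ / 2))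
    (hss : Real.sinh (2 * c) * (Real.sinh (x₀ / 2) * Real.sinh (x₁ / 2)) =
      Real.cosh (a + b - c) * Real.sinh (x₂ / 2))
    (hcs : Real.sinh (2 * c) * (Real.cosh (x₀ / 2) * Real.sinh (x₁ / 2)) =
      Real.cosh (b + c - a) * Real.cosh (x₂ / 2))
    (hsc : Real.sinh (2 * c) * (Real.sinh (x₀ / 2) * Real.cosh (x₁ / 2)) =
      Real.cosh (c + a - b) * Real.cosh (x₂ / 2)) :
    sideStep x₀ (2 * c) * sideStep x₁ (2 * a) = -(sideStep x₂ (2 * b))⁻¹ := by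
  have hcosh := cosh_mul_cosh_sub_cosh_mul_cosh_eq_sinh_mul_sinh a b c
  have hsinh := cosh_mul_sinh_add_cosh_mul_sinh a b c
  have hcosh' := cosh_mul_cosh_sub_cosh_mul_cosh_eq_sinh_mul_sinh a (-b) c
  have hsinh' := cosh_mul_sinh_add_cosh_mul_sinh a (-b) c
  rw [show a + -b + c = c + a - b by ring, show a + -b - c = -(b + c - a) by ring,
    Real.cosh_neg (b + c - a)] at hcosh' hsinh'
  rw [Real.sinh_neg] at hcosh'
  rw [Real.cosh_neg] at hsinh'
  rw [Real.cosh_sub c a, Real.cosh_add c a] at hcosh hcosh'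
  rw [Real.sinh_sub c a, Real.sinh_add c a] at hsinh hsinh'
  set ca := Real.cosh a
  set sa := Real.sinh a
  set cc := Real.cosh c
  set sc := Real.sinh c
  apply Subtype.ext
  rw [Matrix.SpecialLinearGroup.coe_mul, Matrix.SpecialLinearGroup.coe_neg,
    Matrix.SpecialLinearGroup.coe_inv, coe_sideStep, coe_sideStep, coe_sideStep,
    Matrix.adjugate_fin_two_of, Matrix.mul_fin_two]
  simp only [mul_div_cancel_left₀ _ (two_ne_zero (α := ℝ)), ← Real.cosh_add_sinh,
    Real.cosh_neg, Real.sinh_neg]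
  ext i j
  apply mul_left_cancel₀ hc
  fin_cases i <;> fin_cases j <;>
    simp only [Fin.zero_eta, Fin.mk_one, Matrix.neg_apply, Matrix.of_apply, Matrix.cons_val]
  · linear_combination (sc * sa - cc * ca) * (hcc + hsc) + (sc * sa + cc * ca) * (hss + hcs) -
      Real.sinh (x₂ / 2) * hcosh - Real.cosh (x₂ / 2) * hcosh'
  · linear_combination (sc * ca - cc * sa) * (hcc + hsc) + (sc * ca + cc * sa) * (hss + hcs) +
      Real.sinh (x₂ / 2) * hsinh + Real.cosh (x₂ / 2) * hsinh'
  · linear_combination (sc * ca - cc * sa) * (hcc - hsc) + (sc * ca + cc * sa) * (hss - hcs) +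
      Real.sinh (x₂ / 2) * hsinh - Real.cosh (x₂ / 2) * hsinh'
  · linear_combination (sc * sa - cc * ca) * (hcc - hsc) + (sc * sa + cc * ca) * (hss - hcs) -
      Real.sinh (x₂ / 2) * hcosh + Real.cosh (x₂ / 2) * hcosh'

/-- The triples of coordinates `(a + b - c) / 2` of right-angled hexagons. The A-arc facing the
`i`-th red side then has length `r (i + 1) + r (i + 2)`. -/
def coordCone : Set (Fin 3 → ℝ) := {r | ∀ i, 0 < r (i + 1) + r (i + 2)}

/-- The hyperbolic sine of the length of the A-arc facing the `i`-th red side of the hexagon with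
coordinates `r`. -/
def sinhArc (r : Fin 3 → ℝ) (i : Fin 3) : ℝ := Real.sinh (r (i + 1) + r (i + 2))

/-- The length of the `i`-th red side of the hexagon with coordinates `r`, as given by the law of
cosines for right-angled hexagons and the half-angle formula. -/
def redSide (r : Fin 3 → ℝ) (i : Fin 3) : ℝ :=
  2 * Real.arsinh √(Real.cosh (r (i + 1)) * Real.cosh (r (i + 2)) /
    (sinhArc r (i + 1) * sinhArc r (i + 2)))

section RedSide

variable {r : Fin 3 → ℝ} (i : Fin 3)

theorem sinhArc_pos (hr : r ∈ coordCone) : 0 < sinhArc r i := Real.sinh_pos_iff.2 (hr i)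

theorem redSide_radicand_pos (hr : r ∈ coordCone) : 0 < Real.cosh (r (i + 1)) *
    Real.cosh (r (i + 2)) / (sinhArc r (i + 1) * sinhArc r (i + 2)) :=
  div_pos (mul_pos (Real.cosh_pos _) (Real.cosh_pos _))
    (mul_pos (sinhArc_pos _ hr) (sinhArc_pos _ hr))

theorem redSide_pos (hr : r ∈ coordCone) : 0 < redSide r i :=
  mul_pos two_pos <| Real.arsinh_pos_iff.2 <| Real.sqrt_pos.2 <| redSide_radicand_pos i hr

theorem sinh_half_redSide_pos (hr : r ∈ coordCone) : 0 < Real.sinh (redSide r i / 2) :=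
  Real.sinh_pos_iff.2 (half_pos (redSide_pos i hr))

theorem sinh_half_redSide_sq (hr : r ∈ coordCone) : Real.sinh (redSide r i / 2) ^ 2 =
    Real.cosh (r (i + 1)) * Real.cosh (r (i + 2)) / (sinhArc r (i + 1) * sinhArc r (i + 2)) := by
  rw [redSide, mul_div_cancel_left₀ _ two_ne_zero, Real.sinh_arsinh,
    Real.sq_sqrt (redSide_radicand_pos i hr).le]

theorem cosh_half_redSide_sq (hr : r ∈ coordCone) : Real.cosh (redSide r i / 2) ^ 2 =
    Real.cosh (r 0 + r 1 + r 2) * Real.cosh (r i) / (sinhArc r (i + 1) * sinhArc r (i + 2)) := by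
  obtain ⟨h11, h12, h21, h22⟩ := fin_three_add_add i
  have h := cosh_mul_cosh_sub_cosh_mul_cosh (r i) (r (i + 1)) (r (i + 2))
  have h1 := (sinhArc_pos (i + 1) hr).ne'
  have h2 := (sinhArc_pos (i + 2) hr).ne'
  rw [Real.cosh_sq', sinh_half_redSide_sq i hr, eq_div_iff (mul_ne_zero h1 h2), add_mul,
    div_mul_cancel₀ _ (mul_ne_zero h1 h2), ← Fin.sum_univ_three r, sum_fin_three r i]
  simp only [sinhArc, h11, h12, h21, h22]
  linear_combination -h

theorem sinhArc_mul_cosh_mul_cosh (hr : r ∈ coordCone) :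
    sinhArc r (i + 2) * (Real.cosh (redSide r i / 2) * Real.cosh (redSide r (i + 1) / 2)) =
      Real.cosh (r 0 + r 1 + r 2) * Real.sinh (redSide r (i + 2) / 2) := by
  obtain ⟨h11, h12, h21, h22⟩ := fin_three_add_add i
  have hσ (j : Fin 3) := sinhArc_pos j hr
  have hσ' (j : Fin 3) := (hσ j).ne'
  have hS (j : Fin 3) := sinh_half_redSide_pos j hr
  rw [← sq_eq_sq₀ (by positivity [hσ (i + 2), hS i, hS (i + 1)]) (by positivity [hS (i + 2)])]
  simp only [mul_pow, cosh_half_redSide_sq _ hr, sinh_half_redSide_sq _ hr, h11, h12, h21, h22]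
  field_simp [hσ']

theorem sinhArc_mul_sinh_mul_sinh (hr : r ∈ coordCone) :
    sinhArc r (i + 2) * (Real.sinh (redSide r i / 2) * Real.sinh (redSide r (i + 1) / 2)) =
      Real.cosh (r (i + 2)) * Real.sinh (redSide r (i + 2) / 2) := by
  obtain ⟨h11, h12, h21, h22⟩ := fin_three_add_add i
  have hσ (j : Fin 3) := sinhArc_pos j hr
  have hσ' (j : Fin 3) := (hσ j).ne'
  have hS (j : Fin 3) := sinh_half_redSide_pos j hr
  rw [← sq_eq_sq₀ (by positivity [hσ (i + 2), hS i, hS (i + 1)]) (by positivity [hS (i + 2)])]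
  simp only [mul_pow, sinh_half_redSide_sq _ hr, h11, h12, h21, h22]
  field_simp [hσ']

theorem sinhArc_mul_cosh_mul_sinh (hr : r ∈ coordCone) :
    sinhArc r (i + 2) * (Real.cosh (redSide r i / 2) * Real.sinh (redSide r (i + 1) / 2)) =
      Real.cosh (r i) * Real.cosh (redSide r (i + 2) / 2) := by
  obtain ⟨h11, h12, h21, h22⟩ := fin_three_add_add i
  have hσ (j : Fin 3) := sinhArc_pos j hr
  have hσ' (j : Fin 3) := (hσ j).ne'
  have hS (j : Fin 3) := sinh_half_redSide_pos j hr
  rw [← sq_eq_sq₀ (by positivity [hσ (i + 2), hS i, hS (i + 1)]) (by positivity [hS (i + 2)])]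
  simp only [mul_pow, cosh_half_redSide_sq _ hr, sinh_half_redSide_sq _ hr, h11, h12, h21, h22]
  field_simp [hσ']

theorem sinhArc_mul_sinh_mul_cosh (hr : r ∈ coordCone) :
    sinhArc r (i + 2) * (Real.sinh (redSide r i / 2) * Real.cosh (redSide r (i + 1) / 2)) =
      Real.cosh (r (i + 1)) * Real.cosh (redSide r (i + 2) / 2) := by
  obtain ⟨h11, h12, h21, h22⟩ := fin_three_add_add i
  have hσ (j : Fin 3) := sinhArc_pos j hr
  have hσ' (j : Fin 3) := (hσ j).ne'
  have hS (j : Fin 3) := sinh_half_redSide_pos j hr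
  rw [← sq_eq_sq₀ (by positivity [hσ (i + 2), hS i, hS (i + 1)]) (by positivity [hS (i + 2)])]
  simp only [mul_pow, cosh_half_redSide_sq _ hr, sinh_half_redSide_sq _ hr, h11, h12, h21, h22]
  field_simp [hσ']

end RedSide

theorem sideStep_redSide_mul {r : Fin 3 → ℝ} (hr : r ∈ coordCone) :
    sideStep (redSide r 0) (r 0 + r 1) * sideStep (redSide r 1) (r 1 + r 2) *
      sideStep (redSide r 2) (r 2 + r 0) = -1 := by
  have hclose := sideStep_mul_sideStep (a := (r 1 + r 2) / 2) (b := (r 2 + r 0) / 2)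
    (c := (r 0 + r 1) / 2) (x₀ := redSide r 0) (x₁ := redSide r 1) (x₂ := redSide r 2)
  rw [show (r 1 + r 2) / 2 + (r 2 + r 0) / 2 + (r 0 + r 1) / 2 = r 0 + r 1 + r 2 by ring,
    show (r 1 + r 2) / 2 + (r 2 + r 0) / 2 - (r 0 + r 1) / 2 = r 2 by ring,
    show (r 2 + r 0) / 2 + (r 0 + r 1) / 2 - (r 1 + r 2) / 2 = r 0 by ring,
    show (r 0 + r 1) / 2 + (r 1 + r 2) / 2 - (r 2 + r 0) / 2 = r 1 by ring] at hclose
  simp only [mul_div_cancel₀ _ (two_ne_zero (α := ℝ))] at hclose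
  rw [hclose (sinhArc_pos 2 hr).ne' (sinhArc_mul_cosh_mul_cosh 0 hr)
    (sinhArc_mul_sinh_mul_sinh 0 hr) (sinhArc_mul_cosh_mul_sinh 0 hr)
    (sinhArc_mul_sinh_mul_cosh 0 hr), neg_mul, inv_mul_cancel]

theorem neg_one_smul_upperHalfPlane (z : ℍ) : (-1 : SL(2, ℝ)) • z = z := by
  apply UpperHalfPlane.ext
  rw [UpperHalfPlane.coe_specialLinearGroup_apply]
  simp

theorem exists_hexagon {r : Fin 3 → ℝ} (hr : r ∈ coordCone) :
    ∃ H : RightAngledHexagon, (∀ i, H.rCoord i = r i) ∧ ∀ i, H.redLength i = redSide r i := by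
  let θ : Fin 3 → ℝ := fun i => r (i + 1) + r (i + 2)
  let G : Fin 3 → SL(2, ℝ) := ![1, sideStep (redSide r 0) (r 0 + r 1),
    sideStep (redSide r 0) (r 0 + r 1) * sideStep (redSide r 1) (r 1 + r 2)]
  have hG (i : Fin 3) (z : ℍ) :
      G (i + 1) • z = (G i * sideStep (redSide r i) (θ (i + 2))) • z := by
    fin_cases i
    · simp [G, θ]
    · simp [G, θ]
    · simp [G, θ, sideStep_redSide_mul hr, neg_one_smul_upperHalfPlane]
  refine ⟨hexagonOfFrames (fun i => redSide_pos i hr) hr G hG, fun i => ?_, fun i =>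
    redLength_hexagonOfFrames _ _ _ _ _⟩
  have harc := arcLength_hexagonOfFrames (fun i => redSide_pos i hr) hr G hG
  obtain ⟨h11, h12, h21, h22⟩ := fin_three_add_add i
  simp only [RightAngledHexagon.rCoord, harc, h11, h12, h21, h22]
  ring

end Frames

/-! ### Systems of strict difference constraints -/

theorem finite_nodup_lists (α : Type*) [Finite α] : {c : List α | c.Nodup}.Finite := by
  classical
  have := Fintype.ofFinite α
  exact Set.finite_coe_iff.1 (Finite.of_fintype {c : List α // c.Nodup})

section DifferenceConstraints

variable {α : Type*} [Finite α] {R : α → α → Prop} {a l u : α → ℝ}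

/- Take for `w s` the largest value of `l (s_k) - a s_1 - ⋯ - a s_k` on simple paths
`s = s_0, s_1, …, s_k`. -/
theorem exists_weak_difference_solution
    (hcycle : ∀ (c : List α) (h : c ≠ []), c.Nodup → c.IsChain R → R (c.getLast h) (c.head h) →
      0 ≤ (c.map a).sum)
    (hpath : ∀ s c, (s :: c).Nodup → (s :: c).IsChain R → l (c.getLastD s) - (c.map a).sum < u s) :
    ∃ w : α → ℝ, (∀ s, l s ≤ w s ∧ w s < u s) ∧ ∀ s t, R s t → w t - a t ≤ w s := by
  let paths (s : α) : Set (List α) := {c | (s :: c).Nodup ∧ (s :: c).IsChain R}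
  let val (s : α) (c : List α) : ℝ := l (c.getLastD s) - (c.map a).sum
  have hfin (s : α) : (paths s).Finite :=
    (finite_nodup_lists α).subset fun c hc => (List.nodup_cons.1 hc.1).2
  have hnil (s : α) : [] ∈ paths s := ⟨List.nodup_singleton s, List.isChain_singleton s⟩
  choose m hm hmax using fun s => Set.exists_max_image (paths s) (val s) (hfin s) ⟨[], hnil s⟩
  refine ⟨fun s => val s (m s), fun s => ⟨?_, hpath s _ (hm s).1 (hm s).2⟩, fun s t hst => ?_⟩
  · simpa [val] using hmax s [] (hnil s)
  by_cases hs : s ∈ t :: m t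
  · obtain ⟨c, d, hcd⟩ := List.append_of_mem hs
    have hsplit : t :: m t = (c ++ [s]) ++ d := by rw [hcd, List.append_cons]
    obtain ⟨hnodup, hchain⟩ := hm t
    have hle : val s d ≤ val s (m s) := by
      rw [hcd] at hnodup hchain
      exact hmax s d ⟨(List.nodup_append.1 hnodup).2.1, hchain.right_of_append⟩
    have hcyc : 0 ≤ ((c ++ [s]).map a).sum := by
      rw [hsplit] at hnodup hchain
      refine hcycle (c ++ [s]) (by simp) (List.nodup_append.1 hnodup).1 hchain.left_of_append ?_
      convert hst
      · simp
      · cases c <;> simp_all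
    have hlast : (m t).getLastD t = d.getLastD s := by
      rw [← List.getLast_eq_getLastD (List.cons_ne_nil t _), ← List.getLast_eq_getLastD
        (List.cons_ne_nil s _)]
      simp only [hcd]
      exact List.getLast_append_of_ne_nil _ _
    have hsum := congrArg (fun c => (c.map a).sum) hsplit
    simp only [List.map_cons, List.sum_cons, List.map_append, List.sum_append] at hsum hcyc
    simp only [val, hlast] at hle ⊢
    linarith
  · have hle := hmax s (t :: m t)
      ⟨List.nodup_cons.2 ⟨hs, (hm t).1⟩, List.isChain_cons_cons.2 ⟨hst, (hm t).2⟩⟩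
    simp only [val, List.getLastD_cons, List.map_cons, List.sum_cons] at hle ⊢
    linarith

theorem exists_difference_solution
    (hcycle : ∀ (c : List α) (h : c ≠ []), c.Nodup → c.IsChain R → R (c.getLast h) (c.head h) →
      0 < (c.map a).sum)
    (hpath : ∀ s c, (s :: c).Nodup → (s :: c).IsChain R → l (c.getLastD s) - (c.map a).sum < u s) :
    ∃ w : α → ℝ, (∀ s, l s < w s ∧ w s < u s) ∧ ∀ s t, R s t → w t - a t < w s := by
  have hcont (c : List α) : Continuous fun ε : ℝ => (c.map fun s => a s - ε).sum :=
    continuous_list_sum _ fun s _ => by fun_prop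
  have hcycle' : ∀ᶠ ε in nhds (0 : ℝ), ∀ c ∈ {c : List α | c.Nodup}, ∀ h : c ≠ [],
      c.IsChain R → R (c.getLast h) (c.head h) → 0 < (c.map fun s => a s - ε).sum := by
    simp only [Filter.eventually_all_finite (finite_nodup_lists α), Filter.eventually_all]
    intro c hc h hch hR
    refine (hcont c).continuousAt.eventually_const_lt ?_
    simpa only [sub_zero] using hcycle c h hc hch hR
  have hpath' : ∀ᶠ ε in nhds (0 : ℝ), ∀ s, ∀ c ∈ {c : List α | c.Nodup}, (s :: c).Nodup →
      (s :: c).IsChain R → l (c.getLastD s) + ε - (c.map fun s => a s - ε).sum < u s := by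
    simp only [Filter.eventually_all_finite (finite_nodup_lists α), Filter.eventually_all]
    intro s c _ hc hch
    have hcont' : Continuous fun ε => l (c.getLastD s) + ε - (c.map fun s => a s - ε).sum :=
      (continuous_const.add continuous_id).sub (hcont c)
    refine hcont'.continuousAt.eventually_lt_const ?_
    simpa only [add_zero, sub_zero] using hpath s c hc hch
  obtain ⟨ε, ⟨hεc, hεp⟩, hε⟩ := (((hcycle'.and hpath').filter_mono nhdsWithin_le_nhds).and
    (self_mem_nhdsWithin (s := Set.Ioi (0 : ℝ)))).exists
  obtain ⟨w, hw, hwR⟩ := exists_weak_difference_solution (l := fun s => l s + ε)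
    (fun c h hc hch hR => (hεc c hc h hch hR).le)
    fun s c hc hch => hεp s c (List.nodup_cons.1 hc).2 hc hch
  exact ⟨w, fun s => ⟨by linarith [(hw s).1], (hw s).2⟩, fun s t hst => by linarith [hwR s t hst]⟩

end DifferenceConstraints

namespace IdealTriangulation

variable {ι : Type*} (T : IdealTriangulation ι)

theorem edge_glue (s : ι × Fin 3) : T.edge (T.glue s) = T.edge s :=
  Quotient.sound (s := T.sideSetoid) (Or.inr (T.glue_glue s).symm)

theorem lower_sub_pathSum_lt_upper {z : T.Edge → ℝ} {B : ℝ} (hB : 0 < B) (hz : ∀ e, z e < 2 * B)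
    (hpath : ∀ c, c.Nodup → T.IsEdgePath c → -(2 * B) < T.pathSum z c) {s : ι × Fin 3}
    {c : List (ι × Fin 3)} (hc : (s :: c).Nodup) (hch : (s :: c).IsChain T.Follows) :
    max (-B) (z (T.edge (c.getLastD s)) - B) - T.pathSum z c < min B (z (T.edge s) + B) := by
  have hsum (d : List (ι × Fin 3)) (hd : d.Nodup) (hch : d.IsChain T.Follows) :
      -(2 * B) < T.pathSum z d := by
    rcases eq_or_ne d [] with rfl | hne
    · simpa [pathSum] using hB
    · exact hpath d hd ⟨hne, hch⟩
  have hs := hz (T.edge s)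
  have hsc := hsum (s :: c) hc hch
  have hcc := hsum c (List.nodup_cons.1 hc).2 hch.tail
  rw [sub_lt_iff_lt_add, max_lt_iff, ← sub_lt_iff_lt_add, ← sub_lt_iff_lt_add, lt_min_iff,
    lt_min_iff]
  rcases List.eq_nil_or_concat' c with rfl | ⟨d, x, rfl⟩
  · simp only [pathSum, List.getLastD_nil, List.map_cons, List.map_nil, List.sum_cons,
      List.sum_nil] at hsc ⊢
    refine ⟨⟨?_, ?_⟩, ?_, ?_⟩ <;> linarith
  · rw [← List.cons_append] at hc hch
    have hsd := hsum (s :: d) (List.nodup_append.1 hc).1 hch.left_of_append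
    have hdd := hsum d (List.nodup_cons.1 (List.nodup_append.1 hc).1).2 hch.left_of_append.tail
    simp only [pathSum, List.getLastD_concat, List.map_cons, List.map_append, List.sum_cons,
      List.sum_append, List.map_nil, List.sum_nil] at hsc hcc hsd hdd ⊢
    refine ⟨⟨?_, ?_⟩, ?_, ?_⟩ <;> linarith

/- Writing `w (glue s)` as `v s`, the condition on pairs of sides becomes the difference constraint
`v t - z t < v s` along `Follows`. -/
theorem exists_sideWeights [Finite ι] {z : T.Edge → ℝ} {B : ℝ} (hB : 0 < B)
    (hz : ∀ e, z e < 2 * B) (hpath : ∀ c, c.Nodup → T.IsEdgePath c → -(2 * B) < T.pathSum z c)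
    (hcycle : ∀ c, c.Nodup → T.IsEdgeCycle c → 0 < T.pathSum z c) :
    ∃ w : ι × Fin 3 → ℝ, (∀ s, w s + w (T.glue s) = z (T.edge s)) ∧ (∀ s, |w s| < B) ∧
      ∀ s t, s.1 = t.1 → s ≠ t → 0 < w s + w t := by
  obtain ⟨v, hv, hvR⟩ := exists_difference_solution (R := T.Follows) (a := fun s => z (T.edge s))
    (l := fun s => max (-B) (z (T.edge s) - B)) (u := fun s => min B (z (T.edge s) + B))
    (fun c h hc hch hR => hcycle c hc ⟨⟨h, hch⟩, h, hR⟩)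
    fun s c hc hch => T.lower_sub_pathSum_lt_upper hB hz hpath hc hch
  refine ⟨fun s => (v (T.glue s) + z (T.edge s) - v s) / 2, fun s => ?_, fun s => ?_,
    fun s t hst hne => ?_⟩
  · simp only [T.glue_glue, T.edge_glue]
    ring
  · have hs := hv s
    have hg := hv (T.glue s)
    simp only [max_lt_iff, lt_min_iff, T.edge_glue] at hs hg
    rw [abs_lt]
    constructor <;> linarith [hs.1.1, hs.1.2, hs.2.1, hs.2.2, hg.1.1, hg.1.2, hg.2.1, hg.2.2]
  · have hst' := hvR (T.glue s) t
      ⟨by rw [T.glue_glue]; exact hst.symm, by rw [T.glue_glue]; exact hne.symm⟩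
    have hts := hvR (T.glue t) s ⟨by rw [T.glue_glue]; exact hst, by rw [T.glue_glue]; exact hne⟩
    dsimp only
    linarith

end IdealTriangulation

open MeasureTheory Filter Topology

/-! ### The primitive of `cosh ^ lam` -/

/-- The function `r ↦ ∫₀^r cosh^lam t dt`, which turns the coordinate `(a + b - c) / 2` of a red
side into its contribution to the edge invariant. -/
def coshPrimitive (lam r : ℝ) : ℝ := ∫ t in (0 : ℝ)..r, Real.cosh t ^ lam

theorem continuous_cosh_rpow (lam : ℝ) : Continuous fun t : ℝ => Real.cosh t ^ lam :=
  Real.continuous_cosh.rpow_const fun t => Or.inl (Real.cosh_pos t).ne'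

theorem cosh_rpow_pos (lam t : ℝ) : 0 < Real.cosh t ^ lam :=
  Real.rpow_pos_of_pos (Real.cosh_pos t) _

theorem hasStrictDerivAt_coshPrimitive (lam r : ℝ) :
    HasStrictDerivAt (coshPrimitive lam) (Real.cosh r ^ lam) r :=
  intervalIntegral.integral_hasStrictDerivAt_right
    ((continuous_cosh_rpow lam).intervalIntegrable _ _)
    ((continuous_cosh_rpow lam).stronglyMeasurableAtFilter _ _)
    (continuous_cosh_rpow lam).continuousAt

theorem hasDerivAt_coshPrimitive (lam r : ℝ) :
    HasDerivAt (coshPrimitive lam) (Real.cosh r ^ lam) r :=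
  (hasStrictDerivAt_coshPrimitive lam r).hasDerivAt

theorem strictMono_coshPrimitive (lam : ℝ) : StrictMono (coshPrimitive lam) :=
  strictMono_of_hasDerivAt_pos (hasDerivAt_coshPrimitive lam) fun r => cosh_rpow_pos lam r

theorem continuous_coshPrimitive (lam : ℝ) : Continuous (coshPrimitive lam) :=
  continuous_iff_continuousAt.2 fun r => (hasDerivAt_coshPrimitive lam r).continuousAt

theorem coshPrimitive_zero (lam : ℝ) : coshPrimitive lam 0 = 0 := intervalIntegral.integral_same

theorem coshPrimitive_nonneg (lam : ℝ) {r : ℝ} (hr : 0 ≤ r) : 0 ≤ coshPrimitive lam r :=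
  (coshPrimitive_zero lam).symm.trans_le ((strictMono_coshPrimitive lam).monotone hr)

theorem coshPrimitive_neg (lam r : ℝ) : coshPrimitive lam (-r) = -coshPrimitive lam r := by
  have h := intervalIntegral.integral_comp_neg (a := 0) (b := r) fun t : ℝ => Real.cosh t ^ lam
  simp only [Real.cosh_neg, neg_zero] at h
  rw [coshPrimitive, coshPrimitive, h, intervalIntegral.integral_symm]

theorem abs_coshPrimitive (lam r : ℝ) : |coshPrimitive lam r| = coshPrimitive lam |r| := by
  rcases le_total 0 r with hr | hr
  · rw [abs_of_nonneg hr, abs_of_nonneg (coshPrimitive_nonneg lam hr)]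
  · rw [abs_of_nonpos hr, ← abs_neg, ← coshPrimitive_neg,
      abs_of_nonneg (coshPrimitive_nonneg lam (neg_nonneg.2 hr))]

theorem ofReal_coshPrimitive (lam : ℝ) {r : ℝ} (hr : 0 ≤ r) :
    ENNReal.ofReal (coshPrimitive lam r) =
      ∫⁻ t in Set.Ioc 0 r, ENNReal.ofReal (Real.cosh t ^ lam) := by
  rw [coshPrimitive, intervalIntegral.integral_of_le hr, ofReal_integral_eq_lintegral_ofReal]
  · exact ((continuous_cosh_rpow lam).intervalIntegrable 0 r).1
  · exact Eventually.of_forall fun t => (cosh_rpow_pos lam t).le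

theorem coshIntegral_eq_iSup (lam : ℝ) :
    coshIntegral lam = ⨆ n : ℕ, ENNReal.ofReal (coshPrimitive lam n) := by
  have h : Set.Ioi (0 : ℝ) = ⋃ n : ℕ, Set.Ioc (0 : ℝ) n := by
    ext t
    simp only [Set.mem_Ioi, Set.mem_iUnion, Set.mem_Ioc]
    exact ⟨fun ht => (exists_nat_ge t).imp fun n hn => ⟨ht, hn⟩, fun ⟨_, hn⟩ => hn.1⟩
  rw [coshIntegral, h, setLIntegral_iUnion_of_directed]
  · exact iSup_congr fun n => (ofReal_coshPrimitive lam n.cast_nonneg).symm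
  · exact directed_of_isDirected_le fun m n hmn => Set.Ioc_subset_Ioc_right (Nat.cast_le.2 hmn)

theorem ofReal_coshPrimitive_lt (lam : ℝ) {r : ℝ} (hr : 0 ≤ r) :
    ENNReal.ofReal (coshPrimitive lam r) < coshIntegral lam := by
  obtain ⟨n, hn⟩ := exists_nat_gt r
  have hlt := strictMono_coshPrimitive lam hn
  rw [coshIntegral_eq_iSup]
  exact ((ENNReal.ofReal_lt_ofReal_iff ((coshPrimitive_nonneg lam hr).trans_lt hlt)).2 hlt).trans_le
    (le_iSup (fun n : ℕ => ENNReal.ofReal (coshPrimitive lam n)) n)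

theorem exists_coshPrimitive_eq {lam y : ℝ} (hy : 0 ≤ y)
    (h : ENNReal.ofReal y < coshIntegral lam) : ∃ r, coshPrimitive lam r = y := by
  rw [coshIntegral_eq_iSup, lt_iSup_iff] at h
  obtain ⟨n, hn⟩ := h
  have hn' := (ENNReal.ofReal_lt_ofReal_iff'.1 hn).1
  have hivt := intermediate_value_Icc n.cast_nonneg (continuous_coshPrimitive lam).continuousOn
  rw [coshPrimitive_zero] at hivt
  obtain ⟨r, -, hr⟩ := hivt ⟨hy, hn'.le⟩
  exact ⟨r, hr⟩

theorem mem_range_coshPrimitive {lam y : ℝ} :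
    y ∈ Set.range (coshPrimitive lam) ↔ ENNReal.ofReal |y| < coshIntegral lam := by
  constructor
  · rintro ⟨r, rfl⟩
    rw [abs_coshPrimitive]
    exact ofReal_coshPrimitive_lt lam (abs_nonneg r)
  · intro h
    obtain ⟨r, hr⟩ := exists_coshPrimitive_eq (abs_nonneg y) h
    rcases abs_choice y with hy | hy
    · exact ⟨r, hr.trans hy⟩
    · exact ⟨-r, by rw [coshPrimitive_neg, hr, hy, neg_neg]⟩

theorem coshIntegral_pos (lam : ℝ) : 0 < coshIntegral lam :=
  (ofReal_coshPrimitive_lt lam le_rfl).pos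

theorem coshIntegral_of_nonneg {lam : ℝ} (h : 0 ≤ lam) : coshIntegral lam = ⊤ := by
  refine top_unique (le_trans ?_ (lintegral_mono (f := fun _ : ℝ => 1) fun t => ?_))
  · simp
  · rw [← ENNReal.ofReal_one]
    exact ENNReal.ofReal_le_ofReal (Real.one_le_rpow (Real.one_le_cosh t) h)

theorem cosh_rpow_le {lam : ℝ} (h : lam ≤ 0) (t : ℝ) :
    Real.cosh t ^ lam ≤ 2 ^ (-lam) * Real.exp (lam * t) := by
  have hcosh : Real.exp t / 2 ≤ Real.cosh t := by
    rw [Real.cosh_eq]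
    linarith [Real.exp_pos (-t)]
  calc Real.cosh t ^ lam ≤ (Real.exp t / 2) ^ lam :=
        Real.rpow_le_rpow_of_nonpos (half_pos (Real.exp_pos t)) hcosh h
    _ = 2 ^ (-lam) * Real.exp (lam * t) := by
        rw [Real.div_rpow (Real.exp_pos t).le zero_le_two, Real.rpow_neg zero_le_two,
          ← Real.exp_mul, mul_comm t lam, div_eq_inv_mul]

theorem coshIntegral_lt_top {lam : ℝ} (h : lam < 0) : coshIntegral lam < ⊤ :=
  (lintegral_mono fun t => ENNReal.ofReal_le_ofReal (cosh_rpow_le h.le t)).trans_lt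
    ((integrableOn_exp_mul_Ioi h 0).const_mul _).lintegral_lt_top

theorem coshIntegral_strictMonoOn : StrictMonoOn coshIntegral (Set.Iio 0) := by
  refine fun lam₁ h₁ lam₂ _ h => lintegral_strict_mono ?_ ?_ (coshIntegral_lt_top h₁).ne ?_
  · simp
  · exact (continuous_cosh_rpow lam₂).measurable.ennreal_ofReal.aemeasurable
  · refine (ae_restrict_mem measurableSet_Ioi).mono fun t ht => ?_
    rw [ENNReal.ofReal_lt_ofReal_iff (cosh_rpow_pos _ _)]
    exact Real.rpow_lt_rpow_of_exponent_lt (Real.one_lt_cosh.2 (ne_of_gt ht)) h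

theorem tendsto_coshIntegral_atBot : Tendsto coshIntegral atBot (𝓝 0) := by
  rw [← lintegral_zero (μ := volume.restrict (Set.Ioi (0 : ℝ)))]
  refine tendsto_lintegral_filter_of_dominated_convergence
    (fun t => ENNReal.ofReal (Real.cosh t ^ (-1 : ℝ))) (Eventually.of_forall fun lam => ?_) ?_
    (coshIntegral_lt_top neg_one_lt_zero).ne ?_
  · exact (continuous_cosh_rpow lam).measurable.ennreal_ofReal
  · filter_upwards [eventually_le_atBot (-1)] with lam hlam
    exact Eventually.of_forall fun t =>
      ENNReal.ofReal_le_ofReal (Real.rpow_le_rpow_of_exponent_le (Real.one_le_cosh t) hlam)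
  · refine (ae_restrict_mem measurableSet_Ioi).mono fun t ht => ?_
    rw [← ENNReal.ofReal_zero]
    exact ENNReal.tendsto_ofReal
      (tendsto_rpow_atBot_of_base_gt_one _ (Real.one_lt_cosh.2 (ne_of_gt ht)))

theorem isOpenEmbedding_coshPrimitive (lam : ℝ) : IsOpenEmbedding (coshPrimitive lam) :=
  .of_continuous_injective_isOpenMap (continuous_coshPrimitive lam)
    (strictMono_coshPrimitive lam).injective
    (isOpenMap_of_hasStrictDerivAt (hasStrictDerivAt_coshPrimitive lam)
      fun r => (cosh_rpow_pos lam r).ne')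

/-- The inverse of `coshPrimitive lam` on its range. -/
def coshInv (lam : ℝ) : ℝ → ℝ :=
  ((isOpenEmbedding_coshPrimitive lam).toOpenPartialHomeomorph (coshPrimitive lam)).symm

theorem coshInv_coshPrimitive (lam r : ℝ) : coshInv lam (coshPrimitive lam r) = r :=
  (isOpenEmbedding_coshPrimitive lam).toOpenPartialHomeomorph_left_inv

theorem coshPrimitive_coshInv {lam y : ℝ} (hy : y ∈ Set.range (coshPrimitive lam)) :
    coshPrimitive lam (coshInv lam y) = y :=
  (isOpenEmbedding_coshPrimitive lam).toOpenPartialHomeomorph_right_inv _ hy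

theorem hasDerivAt_coshInv {lam y : ℝ} (hy : y ∈ Set.range (coshPrimitive lam)) :
    HasDerivAt (coshInv lam) (Real.cosh (coshInv lam y) ^ (-lam)) y := by
  rw [Real.rpow_neg (Real.cosh_pos _).le]
  exact ((isOpenEmbedding_coshPrimitive lam).toOpenPartialHomeomorph
    (coshPrimitive lam)).hasDerivAt_symm (by simpa using hy) (cosh_rpow_pos lam _).ne'
    (hasDerivAt_coshPrimitive lam _)

/-! ### The slope function -/

/-- For a hexagon with coordinates `a`, `b`, `c` this is `log tanh²(x / 2)`, where `x` is the length
of the red side with coordinate `a`. -/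
def logRatio (a b c : ℝ) : ℝ :=
  Real.log (Real.cosh b) + Real.log (Real.cosh c) - Real.log (Real.cosh (a + b + c)) -
    Real.log (Real.cosh a)

theorem exp_logRatio (a b c : ℝ) : Real.exp (logRatio a b c) =
    Real.cosh b * Real.cosh c / (Real.cosh (a + b + c) * Real.cosh a) := by
  rw [logRatio, Real.exp_sub, Real.exp_sub, Real.exp_add, Real.exp_log (Real.cosh_pos _),
    Real.exp_log (Real.cosh_pos _), Real.exp_log (Real.cosh_pos _), Real.exp_log (Real.cosh_pos _),
    div_div]

theorem one_sub_exp_logRatio (a b c : ℝ) : 1 - Real.exp (logRatio a b c) =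
    Real.sinh (c + a) * Real.sinh (a + b) / (Real.cosh (a + b + c) * Real.cosh a) := by
  have h := mul_ne_zero (Real.cosh_pos (a + b + c)).ne' (Real.cosh_pos a).ne'
  rw [exp_logRatio, ← cosh_mul_cosh_sub_cosh_mul_cosh, sub_div, div_self h]

theorem logRatio_neg {a b c : ℝ} (hca : 0 < c + a) (hab : 0 < a + b) : logRatio a b c < 0 := by
  rw [← Real.exp_lt_one_iff, ← sub_pos, one_sub_exp_logRatio]
  exact div_pos (mul_pos (Real.sinh_pos_iff.2 hca) (Real.sinh_pos_iff.2 hab))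
    (mul_pos (Real.cosh_pos _) (Real.cosh_pos _))

/-- A primitive of `exp ((1 + lam / 2) x) / (1 - exp x)` on the negative reals. The partial
derivatives of the potential of a hexagon are the values of `slope lam` at the numbers
`logRatio a b c`. -/
def slope (lam x : ℝ) : ℝ :=
  ∫ t in (-1 : ℝ)..x, Real.exp ((1 + lam / 2) * t) / (1 - Real.exp t)

theorem one_sub_exp_pos {x : ℝ} (hx : x < 0) : 0 < 1 - Real.exp x :=
  sub_pos.2 (Real.exp_lt_one_iff.2 hx)

theorem hasDerivAt_slope (lam : ℝ) {x : ℝ} (hx : x < 0) :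
    HasDerivAt (slope lam) (Real.exp ((1 + lam / 2) * x) / (1 - Real.exp x)) x := by
  have hcont : ContinuousOn (fun t => Real.exp ((1 + lam / 2) * t) / (1 - Real.exp t))
      (Set.Iio 0) :=
    .div (by fun_prop) (by fun_prop) fun t ht => (one_sub_exp_pos ht).ne'
  exact intervalIntegral.integral_hasDerivAt_right
    (hcont.mono fun t ht => ht.2.trans_lt (max_lt neg_one_lt_zero hx)).intervalIntegrable
    (hcont.stronglyMeasurableAtFilter isOpen_Iio x hx) (hcont.continuousAt (Iio_mem_nhds hx))

theorem slope_strictMonoOn (lam : ℝ) : StrictMonoOn (slope lam) (Set.Iio 0) := by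
  refine strictMonoOn_of_deriv_pos (convex_Iio 0)
    (fun x hx => (hasDerivAt_slope lam hx).continuousAt.continuousWithinAt) fun x hx => ?_
  rw [interior_Iio] at hx
  rw [(hasDerivAt_slope lam hx).deriv]
  exact div_pos (Real.exp_pos _) (one_sub_exp_pos hx)

theorem exp_neg_abs_div_neg_le (k : ℝ) {x : ℝ} (hx : x ∈ Set.Ioo (-1) 0) :
    Real.exp (-|k|) / -x ≤ Real.exp (k * x) / (1 - Real.exp x) := by
  refine div_le_div₀ (Real.exp_pos _).le (Real.exp_le_exp.2 ?_) (one_sub_exp_pos hx.2)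
    (by linarith [Real.add_one_le_exp x])
  calc -|k| ≤ -(|k| * |x|) := neg_le_neg <|
        mul_le_of_le_one_right (abs_nonneg k) (abs_le.2 ⟨hx.1.le, hx.2.le.trans zero_le_one⟩)
    _ = -|k * x| := by rw [abs_mul]
    _ ≤ k * x := neg_abs_le _

theorem monotoneOn_slope_add_log (lam : ℝ) : MonotoneOn
    (fun x => slope lam x + Real.exp (-|1 + lam / 2|) * Real.log (-x)) (Set.Ioo (-1) 0) := by
  have hderiv (x : ℝ) (hx : x ∈ Set.Ioo (-1 : ℝ) 0) :=
    (hasDerivAt_slope lam hx.2).add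
      (((hasDerivAt_id x).neg.log (neg_ne_zero.2 hx.2.ne)).const_mul (Real.exp (-|1 + lam / 2|)))
  refine monotoneOn_of_hasDerivWithinAt_nonneg (convex_Ioo _ _)
    (fun x hx => (hderiv x hx).continuousAt.continuousWithinAt)
    (fun x hx => (hderiv x (interior_subset hx)).hasDerivWithinAt) fun x hx => ?_
  have hle := exp_neg_abs_div_neg_le (1 + lam / 2) (interior_subset hx)
  rw [← mul_div_assoc, mul_neg_one, neg_div]
  exact sub_nonneg.2 hle

theorem tendsto_slope_zero (lam : ℝ) : Tendsto (slope lam) (𝓝[<] 0) atTop := by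
  have hneg : Tendsto (fun x : ℝ => -x) (𝓝[<] 0) (𝓝[>] 0) := by
    simpa only [neg_zero] using tendsto_neg_nhdsLT (a := (0 : ℝ))
  have hlog : Tendsto (fun x : ℝ => -(Real.exp (-|1 + lam / 2|) * Real.log (-x))) (𝓝[<] 0) atTop :=
    tendsto_neg_atBot_atTop.comp
      ((Real.tendsto_log_nhdsGT_zero.comp hneg).const_mul_atBot (Real.exp_pos _))
  have hhalf : (-1 / 2 : ℝ) ∈ Set.Ioo (-1 : ℝ) 0 := by constructor <;> norm_num
  refine tendsto_atTop_mono' _ ?_ (tendsto_atTop_add_const_left _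
    (slope lam (-1 / 2) + Real.exp (-|1 + lam / 2|) * Real.log (-(-1 / 2))) hlog)
  filter_upwards [Ioo_mem_nhdsLT hhalf.2] with x hx
  have hmono := monotoneOn_slope_add_log lam hhalf ⟨hhalf.1.trans hx.1, hx.2⟩ hx.1.le
  dsimp only at hmono
  linarith

/-! ### The potential of a hexagon -/

/-- The triples `∫₀^{r i} cosh^lam` for the coordinates `r` of right-angled hexagons. -/
def weightCone (lam : ℝ) : Set (Fin 3 → ℝ) :=
  {w | (∀ i, w i ∈ Set.range (coshPrimitive lam)) ∧ ∀ i, 0 < w (i + 1) + w (i + 2)}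

/-- The coordinates of the hexagon with given `∫₀^{r i} cosh^lam`. -/
def coords (lam : ℝ) (w : Fin 3 → ℝ) (i : Fin 3) : ℝ := coshInv lam (w i)

/-- The logarithm of `tanh²(x / 2)`, `x` the length of the `i`-th red side. -/
def sideLog (r : Fin 3 → ℝ) (i : Fin 3) : ℝ := logRatio (r i) (r (i + 1)) (r (i + 2))

/-- The partial derivatives of the potential of a hexagon; they are increasing functions of the
lengths of the red sides. -/
def hexSlope (lam : ℝ) (w : Fin 3 → ℝ) (i : Fin 3) : ℝ := slope lam (sideLog (coords lam w) i)

/-- The factor common to all second partial derivatives of the potential. -/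
def hexWeight (lam : ℝ) (r : Fin 3 → ℝ) : ℝ :=
  ((∏ i, Real.cosh (r i)) / Real.cosh (∑ i, r i)) ^ (1 + lam / 2)

/-- The second derivative of the potential at the hexagon with coordinates `r`, as a bilinear form
in `x i = cosh (r i) ^ (-1 - lam) * d i`, where `d` is a direction of weights. -/
def hexHessian (lam : ℝ) (r x y : Fin 3 → ℝ) : ℝ :=
  -(hexWeight lam r / ∏ i, sinhArc r i) * ∑ k, sinhArc r (k + 1) * sinhArc r (k + 2) *
    (Real.cosh (r (k + 1) + r (k + 2)) * (x (k + 1) * y (k + 1) + x (k + 2) * y (k + 2)) +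
      x (k + 1) * y (k + 2) + x (k + 2) * y (k + 1))

/-- The coefficients of the linear form `hexHessian lam r x`. -/
def hexHessianRow (lam : ℝ) (r x : Fin 3 → ℝ) (i : Fin 3) : ℝ :=
  -(hexWeight lam r / (sinhArc r (i + 1) * sinhArc r (i + 2))) *
    (sinhArc r (i + 1) * x (i + 1) + sinhArc r (i + 2) * x (i + 2) +
      Real.sinh (r (i + 2) + r i + (r i + r (i + 1))) * x i)

/-- The direction `d` in the normalization in which `hexHessian` is expressed. -/
def scaledDir (lam : ℝ) (w d : Fin 3 → ℝ) (i : Fin 3) : ℝ :=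
  Real.cosh (coords lam w i) ^ (-1 - lam) * d i

theorem isOpen_range_coshPrimitive (lam : ℝ) : IsOpen (Set.range (coshPrimitive lam)) :=
  (isOpenEmbedding_coshPrimitive lam).isOpen_range

theorem convex_range_coshPrimitive (lam : ℝ) : Convex ℝ (Set.range (coshPrimitive lam)) :=
  (isPreconnected_range (continuous_coshPrimitive lam)).ordConnected.convex

theorem weightCone_eq (lam : ℝ) : weightCone lam =
    (⋂ i, {w | w i ∈ Set.range (coshPrimitive lam)}) ∩ ⋂ i, {w | 0 < w (i + 1) + w (i + 2)} := by
  ext w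
  simp [weightCone]

theorem isOpen_weightCone (lam : ℝ) : IsOpen (weightCone lam) := by
  rw [weightCone_eq]
  exact (isOpen_iInter_of_finite fun i =>
    (isOpen_range_coshPrimitive lam).preimage (continuous_apply i)).inter
    (isOpen_iInter_of_finite fun i => isOpen_lt continuous_const
      ((continuous_apply _).add (continuous_apply _)))

theorem convex_weightCone (lam : ℝ) : Convex ℝ (weightCone lam) := by
  rw [weightCone_eq]
  exact (convex_iInter fun i => (convex_range_coshPrimitive lam).is_linear_preimage
    (LinearMap.proj i : (Fin 3 → ℝ) →ₗ[ℝ] ℝ).isLinear).inter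
    (convex_iInter fun i => convex_halfSpace_gt (f := fun w : Fin 3 → ℝ => w (i + 1) + w (i + 2))
      ⟨fun _ _ => add_add_add_comm .., fun _ _ => (mul_add ..).symm⟩ 0)

theorem coshInv_add_pos {lam x y : ℝ} (hx : x ∈ Set.range (coshPrimitive lam))
    (hy : y ∈ Set.range (coshPrimitive lam)) (h : 0 < x + y) :
    0 < coshInv lam x + coshInv lam y := by
  rw [← coshPrimitive_coshInv hx, ← coshPrimitive_coshInv hy, ← neg_lt_iff_pos_add,
    ← coshPrimitive_neg, (strictMono_coshPrimitive lam).lt_iff_lt] at h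
  exact neg_lt_iff_pos_add.1 h

theorem coords_mem {lam : ℝ} {w : Fin 3 → ℝ} (hw : w ∈ weightCone lam) :
    coords lam w ∈ coordCone := fun i => coshInv_add_pos (hw.1 _) (hw.1 _) (hw.2 i)

theorem coordCone_next {r : Fin 3 → ℝ} (hr : r ∈ coordCone) (i : Fin 3) :
    0 < r (i + 2) + r i ∧ 0 < r i + r (i + 1) := by
  obtain ⟨h11, h12, h21, h22⟩ := fin_three_add_add i
  have h1 := hr (i + 1)
  have h2 := hr (i + 2)
  rw [h11, h12] at h1
  rw [h21, h22] at h2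
  exact ⟨h1, h2⟩

theorem sideLog_neg {r : Fin 3 → ℝ} (hr : r ∈ coordCone) (i : Fin 3) : sideLog r i < 0 :=
  logRatio_neg (coordCone_next hr i).1 (coordCone_next hr i).2

theorem hexWeight_eq (lam : ℝ) (r : Fin 3 → ℝ) (i : Fin 3) : hexWeight lam r =
    (Real.cosh (r i) * Real.cosh (r (i + 1)) * Real.cosh (r (i + 2)) /
      Real.cosh (r i + r (i + 1) + r (i + 2))) ^ (1 + lam / 2) := by
  rw [hexWeight, prod_fin_three _ i, sum_fin_three _ i]

theorem hexWeight_pos (lam : ℝ) (r : Fin 3 → ℝ) : 0 < hexWeight lam r :=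
  Real.rpow_pos_of_pos
    (div_pos (Finset.prod_pos fun i _ => Real.cosh_pos (r i)) (Real.cosh_pos _)) _

section Derivatives

variable {a b c : ℝ → ℝ} {x y z τ : ℝ}

theorem hasDerivAt_logRatio (ha : HasDerivAt a (Real.cosh (a τ) * x) τ)
    (hb : HasDerivAt b (Real.cosh (b τ) * y) τ) (hc : HasDerivAt c (Real.cosh (c τ) * z) τ) :
    HasDerivAt (fun t => logRatio (a t) (b t) (c t))
      (-(Real.sinh (c τ + a τ) * y + Real.sinh (a τ + b τ) * z +
        Real.sinh (c τ + a τ + (a τ + b τ)) * x) / Real.cosh (a τ + b τ + c τ)) τ := by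
  have hne (u : ℝ) := (Real.cosh_pos u).ne'
  have hb_diff : Real.sinh (c τ + a τ) = Real.sinh (a τ + b τ + c τ - b τ) := by ring_nf
  have hc_diff : Real.sinh (a τ + b τ) = Real.sinh (a τ + b τ + c τ - c τ) := by ring_nf
  have ha_add : Real.sinh (c τ + a τ + (a τ + b τ)) = Real.sinh (a τ + b τ + c τ + a τ) := by
    ring_nf
  refine (((hb.cosh.log (hne _)).add (hc.cosh.log (hne _))).sub
    (((ha.add hb).add hc).cosh.log (hne _))).sub (ha.cosh.log (hne _)) |>.congr_deriv ?_
  simp only [Pi.add_apply]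
  rw [hb_diff, hc_diff, ha_add, Real.sinh_sub, Real.sinh_sub, Real.sinh_add _ (a τ)]
  field_simp [hne]
  ring

theorem exp_mul_logRatio (lam a b c : ℝ) : Real.exp ((1 + lam / 2) * logRatio a b c) =
    (Real.cosh a * Real.cosh b * Real.cosh c / Real.cosh (a + b + c)) ^ (1 + lam / 2) *
      Real.cosh a ^ (-1 - lam) / Real.cosh a := by
  have ha := Real.cosh_pos a
  have hratio : Real.exp (logRatio a b c) =
      Real.cosh a * Real.cosh b * Real.cosh c / Real.cosh (a + b + c) *
        Real.cosh a ^ (-2 : ℝ) := by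
    rw [exp_logRatio, Real.rpow_neg ha.le, Real.rpow_two]
    field_simp
  rw [mul_comm, Real.exp_mul, hratio, Real.mul_rpow (by positivity) (by positivity),
    ← Real.rpow_mul ha.le, mul_div_assoc _ (Real.cosh a ^ (-1 - lam)), ← Real.rpow_sub_one ha.ne']
  ring_nf

theorem hasDerivAt_slope_logRatio (lam : ℝ) (ha : HasDerivAt a (Real.cosh (a τ) * x) τ)
    (hb : HasDerivAt b (Real.cosh (b τ) * y) τ) (hc : HasDerivAt c (Real.cosh (c τ) * z) τ)
    (hca : 0 < c τ + a τ) (hab : 0 < a τ + b τ) :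
    HasDerivAt (fun t => slope lam (logRatio (a t) (b t) (c t)))
      (-((Real.cosh (a τ) * Real.cosh (b τ) * Real.cosh (c τ) / Real.cosh (a τ + b τ + c τ)) ^
          (1 + lam / 2) / (Real.sinh (c τ + a τ) * Real.sinh (a τ + b τ))) *
        (Real.sinh (c τ + a τ) * y + Real.sinh (a τ + b τ) * z +
          Real.sinh (c τ + a τ + (a τ + b τ)) * x) * Real.cosh (a τ) ^ (-1 - lam)) τ := by
  refine (hasDerivAt_slope lam (logRatio_neg hca hab)).comp τ (hasDerivAt_logRatio ha hb hc)
    |>.congr_deriv ?_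
  rw [exp_mul_logRatio, one_sub_exp_logRatio]
  have ha' := (Real.cosh_pos (a τ)).ne'
  have hs := (Real.cosh_pos (a τ + b τ + c τ)).ne'
  have hca' := (Real.sinh_pos_iff.2 hca).ne'
  have hab' := (Real.sinh_pos_iff.2 hab).ne'
  field_simp

theorem hasDerivAt_ray (w d : Fin 3 → ℝ) (i : Fin 3) (τ : ℝ) :
    HasDerivAt (fun t : ℝ => (w + t • d) i) (d i) τ := by
  simpa using ((hasDerivAt_id τ).mul_const (d i)).const_add (w i)

variable {lam : ℝ} {w d : Fin 3 → ℝ}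

theorem hasDerivAt_coords {i : Fin 3} (h : (w + τ • d) i ∈ Set.range (coshPrimitive lam)) :
    HasDerivAt (fun t : ℝ => coords lam (w + t • d) i)
      (Real.cosh (coords lam (w + τ • d) i) * scaledDir lam (w + τ • d) d i) τ := by
  refine ((hasDerivAt_coshInv h).comp τ (hasDerivAt_ray w d i τ)).congr_deriv ?_
  have hpow : -lam = -1 - lam + 1 := by ring
  rw [scaledDir, ← coords, hpow, Real.rpow_add_one (Real.cosh_pos _).ne',
    mul_comm (_ ^ (-1 - lam)), mul_assoc]

theorem hasDerivAt_hexSlope (h : w + τ • d ∈ weightCone lam) (i : Fin 3) :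
    HasDerivAt (fun t : ℝ => hexSlope lam (w + t • d) i)
      (hexHessianRow lam (coords lam (w + τ • d)) (scaledDir lam (w + τ • d) d) i *
        Real.cosh (coords lam (w + τ • d) i) ^ (-1 - lam)) τ := by
  obtain ⟨hca, hab⟩ := coordCone_next (coords_mem h) i
  obtain ⟨h11, h12, h21, h22⟩ := fin_three_add_add i
  rw [hexHessianRow, sinhArc, sinhArc, h11, h12, h21, h22, hexWeight_eq lam _ i]
  exact hasDerivAt_slope_logRatio lam (hasDerivAt_coords (h.1 i)) (hasDerivAt_coords (h.1 (i + 1)))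
    (hasDerivAt_coords (h.1 (i + 2))) hca hab

end Derivatives

section Hessian

variable {lam : ℝ} {r : Fin 3 → ℝ}

theorem hexHessian_eq_sum (hr : r ∈ coordCone) (x y : Fin 3 → ℝ) :
    hexHessian lam r x y = ∑ i, hexHessianRow lam r x i * y i := by
  have h0 := (sinhArc_pos 0 hr).ne'
  have h1 := (sinhArc_pos 1 hr).ne'
  have h2 := (sinhArc_pos 2 hr).ne'
  have hsinh (i : Fin 3) : Real.sinh (r (i + 2) + r i + (r i + r (i + 1))) =
      sinhArc r (i + 1) * Real.cosh (r i + r (i + 1)) +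
        Real.cosh (r (i + 2) + r i) * sinhArc r (i + 2) := by
    obtain ⟨h11, h12, h21, h22⟩ := fin_three_add_add i
    rw [Real.sinh_add, sinhArc, sinhArc, h11, h12, h21, h22]
  simp only [hexHessian, hexHessianRow, hsinh, Fin.sum_univ_three, Fin.prod_univ_three, zero_add,
    Fin.reduceAdd]
  field_simp
  ring

theorem hexHessian_comm (lam : ℝ) (r x y : Fin 3 → ℝ) :
    hexHessian lam r x y = hexHessian lam r y x :=
  congrArg _ (Finset.sum_congr rfl fun k _ => by ring)

theorem hexHessian_self_le (lam : ℝ) (hr : r ∈ coordCone) (x : Fin 3 → ℝ) (k : Fin 3) :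
    hexHessian lam r x x ≤ -(hexWeight lam r / sinhArc r k * (x (k + 1) + x (k + 2)) ^ 2) := by
  have hpos (j : Fin 3) : 0 < sinhArc r (j + 1) * sinhArc r (j + 2) :=
    mul_pos (sinhArc_pos _ hr) (sinhArc_pos _ hr)
  have hterm (j : Fin 3) : sinhArc r (j + 1) * sinhArc r (j + 2) * (x (j + 1) + x (j + 2)) ^ 2 ≤
      sinhArc r (j + 1) * sinhArc r (j + 2) * (Real.cosh (r (j + 1) + r (j + 2)) *
        (x (j + 1) * x (j + 1) + x (j + 2) * x (j + 2)) +
        x (j + 1) * x (j + 2) + x (j + 2) * x (j + 1)) := by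
    refine mul_le_mul_of_nonneg_left ?_ (hpos j).le
    linarith [le_mul_of_one_le_left (add_nonneg (mul_self_nonneg (x (j + 1)))
      (mul_self_nonneg (x (j + 2)))) (Real.one_le_cosh (r (j + 1) + r (j + 2)))]
  have hsum := (hterm k).trans (Finset.single_le_sum (fun j _ =>
    (mul_nonneg (hpos j).le (sq_nonneg _)).trans (hterm j)) (Finset.mem_univ k))
  rw [hexHessian, neg_mul, neg_le_neg_iff, prod_fin_three _ k, mul_assoc (sinhArc r k)]
  refine le_trans (le_of_eq ?_) (mul_le_mul_of_nonneg_left hsum (div_pos (hexWeight_pos lam r)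
    (mul_pos (sinhArc_pos k hr) (hpos k))).le)
  rw [← div_div, ← mul_assoc, div_mul_cancel₀ _ (hpos k).ne']

theorem hexHessian_self_nonpos (lam : ℝ) (hr : r ∈ coordCone) (x : Fin 3 → ℝ) :
    hexHessian lam r x x ≤ 0 :=
  (hexHessian_self_le lam hr x 0).trans (neg_nonpos.2
    (mul_nonneg (div_pos (hexWeight_pos lam r) (sinhArc_pos 0 hr)).le (sq_nonneg _)))

end Hessian

section Potential

variable {lam τ : ℝ} {w d : Fin 3 → ℝ}

theorem hasDerivAt_sum_hexSlope (h : w + τ • d ∈ weightCone lam) (e : Fin 3 → ℝ) :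
    HasDerivAt (fun t : ℝ => ∑ i, hexSlope lam (w + t • d) i * e i)
      (hexHessian lam (coords lam (w + τ • d)) (scaledDir lam (w + τ • d) d)
        (scaledDir lam (w + τ • d) e)) τ := by
  rw [hexHessian_eq_sum (coords_mem h)]
  refine (HasDerivAt.fun_sum fun i _ => (hasDerivAt_hexSlope h i).mul_const (e i)).congr_deriv
    (Finset.sum_congr rfl fun i _ => ?_)
  rw [scaledDir.eq_def lam _ e, mul_assoc]

theorem differentiableAt_hexSlope (hw : w ∈ weightCone lam) (i : Fin 3) :
    DifferentiableAt ℝ (fun w => hexSlope lam w i) w := by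
  have hcoords (j : Fin 3) : DifferentiableAt ℝ (fun w => coords lam w j) w :=
    (hasDerivAt_coshInv (hw.1 j)).differentiableAt.comp w (differentiableAt_apply j w)
  have hne (x : ℝ) : Real.cosh x ≠ 0 := (Real.cosh_pos x).ne'
  refine (hasDerivAt_slope lam (sideLog_neg (coords_mem hw) i)).differentiableAt.comp w ?_
  simp only [sideLog, logRatio]
  fun_prop (disch := intros; apply hne)

/-- The differential of the potential of a hexagon, as a 1-form in the weights. -/
def hexForm (lam : ℝ) (w : Fin 3 → ℝ) : (Fin 3 → ℝ) →L[ℝ] ℝ :=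
  ∑ i, hexSlope lam w i • ContinuousLinearMap.proj i

theorem hexForm_apply (lam : ℝ) (w d : Fin 3 → ℝ) :
    hexForm lam w d = ∑ i, hexSlope lam w i * d i := by
  simp [hexForm]

theorem differentiableAt_hexForm (hw : w ∈ weightCone lam) :
    DifferentiableAt ℝ (hexForm lam) w :=
  DifferentiableAt.fun_sum fun i _ => (differentiableAt_hexSlope hw i).smul_const _

theorem fderiv_hexForm_apply (hw : w ∈ weightCone lam) (x y : Fin 3 → ℝ) :
    fderiv ℝ (hexForm lam) w x y =
      hexHessian lam (coords lam w) (scaledDir lam w x) (scaledDir lam w y) := by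
  have hw0 : w + (0 : ℝ) • x = w := by rw [zero_smul, add_zero]
  have hform := ((differentiableAt_hexForm hw).hasFDerivAt.hasLineDerivAt x).clm_apply
    (hasDerivAt_const (0 : ℝ) y)
  rw [map_zero, add_zero] at hform
  simp only [hexForm_apply] at hform
  have hsum := hasDerivAt_sum_hexSlope (hw0.symm ▸ hw) y
  rw [hw0] at hsum
  exact hform.unique hsum

theorem exists_hexPotential (lam : ℝ) :
    ∃ V : (Fin 3 → ℝ) → ℝ, ∀ w ∈ weightCone lam, HasFDerivAt V (hexForm lam w) w :=
  (convex_weightCone lam).exists_forall_hasFDerivAt_of_fderiv_symmetric (isOpen_weightCone lam)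
    (fun w hw => (differentiableAt_hexForm hw).differentiableWithinAt) fun w hw x y => by
      rw [fderiv_hexForm_apply hw, fderiv_hexForm_apply hw, hexHessian_comm]

/-- The potential of a hexagon: the closed 1-form `hexForm` has a primitive. -/
def hexPotential (lam : ℝ) : (Fin 3 → ℝ) → ℝ := (exists_hexPotential lam).choose

theorem hasFDerivAt_hexPotential (hw : w ∈ weightCone lam) :
    HasFDerivAt (hexPotential lam) (hexForm lam w) w := (exists_hexPotential lam).choose_spec w hw

theorem hasDerivAt_hexPotential (h : w + τ • d ∈ weightCone lam) :
    HasDerivAt (fun t : ℝ => hexPotential lam (w + t • d))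
      (∑ i, hexSlope lam (w + τ • d) i * d i) τ := by
  rw [← hexForm_apply]
  exact (hasFDerivAt_hexPotential h).comp_hasDerivAt τ
    (hasDerivAt_pi.2 fun i => hasDerivAt_ray w d i τ)

theorem continuousOn_hexPotential (lam : ℝ) : ContinuousOn (hexPotential lam) (weightCone lam) :=
  fun _ hw => (hasFDerivAt_hexPotential hw).continuousAt.continuousWithinAt

theorem antitoneOn_sum_hexSlope {s : Set ℝ} (hs : Convex ℝ s)
    (h : ∀ τ ∈ s, w + τ • d ∈ weightCone lam) :
    AntitoneOn (fun t : ℝ => ∑ i, hexSlope lam (w + t • d) i * d i) s :=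
  antitoneOn_of_hasDerivWithinAt_nonpos hs
    (fun τ hτ => (hasDerivAt_sum_hexSlope (h τ hτ) d).continuousAt.continuousWithinAt)
    (fun τ hτ => (hasDerivAt_sum_hexSlope (h τ (interior_subset hτ)) d).hasDerivWithinAt)
    fun τ hτ => hexHessian_self_nonpos lam (coords_mem (h τ (interior_subset hτ))) _

end Potential

/-! ### The potential at the boundary of the weight cone -/

section LogCosh

theorem log_cosh_eq (x : ℝ) :
    Real.log (Real.cosh x) = x - Real.log 2 + Real.log (1 + Real.exp (-2 * x)) := by
  have hpos : 0 < 1 + Real.exp (-2 * x) := by positivity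
  have hcosh : Real.cosh x = Real.exp x / 2 * (1 + Real.exp (-2 * x)) := by
    rw [Real.cosh_eq, mul_add, mul_one, div_mul_eq_mul_div, ← Real.exp_add]
    ring_nf
  rw [hcosh, Real.log_mul (by positivity) hpos.ne', Real.log_div (Real.exp_pos x).ne' two_ne_zero,
    Real.log_exp]

theorem sub_log_two_le_log_cosh (x : ℝ) : x - Real.log 2 ≤ Real.log (Real.cosh x) := by
  rw [log_cosh_eq]
  exact le_add_of_nonneg_right (Real.log_nonneg (le_add_of_nonneg_right (Real.exp_pos _).le))

theorem log_cosh_le (x : ℝ) : Real.log (Real.cosh x) ≤ x - Real.log 2 + Real.exp (-2 * x) := by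
  have hpos : 0 < 1 + Real.exp (-2 * x) := by positivity
  rw [log_cosh_eq]
  linarith [Real.log_le_sub_one_of_pos hpos]

theorem log_cosh_add_le (x y : ℝ) :
    Real.log (Real.cosh (x + y)) ≤ Real.log (Real.cosh x) + |y| := by
  have hcosh : Real.cosh (x + y) ≤ Real.cosh x * Real.exp |y| := by
    rw [Real.cosh_eq, Real.cosh_eq, neg_add, Real.exp_add, Real.exp_add, div_mul_eq_mul_div,
      add_mul]
    gcongr
    exacts [le_abs_self y, neg_le_abs y]
  calc Real.log (Real.cosh (x + y)) ≤ Real.log (Real.cosh x * Real.exp |y|) :=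
        Real.log_le_log (Real.cosh_pos _) hcosh
    _ = Real.log (Real.cosh x) + |y| := by
        rw [Real.log_mul (Real.cosh_pos x).ne' (Real.exp_pos _).ne', Real.log_exp]

theorem log_cosh_nonneg (x : ℝ) : 0 ≤ Real.log (Real.cosh x) := Real.log_nonneg (Real.one_le_cosh x)

theorem log_cosh_le_abs (x : ℝ) : Real.log (Real.cosh x) ≤ |x| := by
  simpa using log_cosh_add_le 0 x

theorem abs_sub_log_two_le_log_cosh (x : ℝ) : |x| - Real.log 2 ≤ Real.log (Real.cosh x) := by
  rw [← Real.cosh_abs]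
  exact sub_log_two_le_log_cosh |x|

theorem le_logRatio (a b c : ℝ) : -(2 * |a| + 2 * Real.log 2) ≤ logRatio a b c := by
  rw [logRatio]
  linarith [abs_sub_log_two_le_log_cosh b, abs_sub_log_two_le_log_cosh c, log_cosh_le_abs a,
    log_cosh_le_abs (a + b + c), abs_add_three a b c]

theorem logRatio_le {a b c M : ℝ} (hM : 0 ≤ M) (hb : -M ≤ b) (hc : -M ≤ c) :
    logRatio a b c ≤ 4 * M + 2 * Real.log 2 - 2 * a := by
  have hb' : |b| ≤ b + 2 * M := abs_le.2 ⟨by linarith, by linarith⟩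
  have hc' : |c| ≤ c + 2 * M := abs_le.2 ⟨by linarith, by linarith⟩
  rw [logRatio]
  linarith [log_cosh_le_abs b, log_cosh_le_abs c, sub_log_two_le_log_cosh a,
    sub_log_two_le_log_cosh (a + b + c)]

theorem neg_two_mul_exp_le_logRatio {a b c : ℝ} (hca : 0 < c + a) (hab : 0 < a + b) :
    -(2 * Real.exp (2 * a)) ≤ logRatio a b c := by
  have ha := log_cosh_le (-a)
  have hs : Real.exp (-2 * (a + b + c)) ≤ Real.exp (2 * a) := Real.exp_le_exp.2 (by linarith)
  rw [Real.cosh_neg, neg_mul_neg] at ha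
  rw [logRatio]
  linarith [sub_log_two_le_log_cosh b, sub_log_two_le_log_cosh c, log_cosh_le (a + b + c)]

theorem tanh_mul_tanh_le {a b c : ℝ} (ha : 0 ≤ a) (hs : 0 ≤ a + b + c) (hca : 0 ≤ c + a)
    (hab : 0 ≤ a + b) :
    Real.tanh (c + a) * Real.tanh (a + b) / 2 ≤ 1 - Real.exp (logRatio a b c) := by
  have hcosh : Real.cosh (a + b + c) * Real.cosh a ≤
      2 * (Real.cosh (c + a) * Real.cosh (a + b)) := by
    have hsum := Real.cosh_add (a + b + c) a
    have hsum' := Real.cosh_add (c + a) (a + b)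
    have hdiff := Real.cosh_sub (c + a) (a + b)
    have heq : a + b + c + a = c + a + (a + b) := by ring
    rw [heq] at hsum
    linarith [mul_nonneg (Real.sinh_nonneg_iff.2 hs) (Real.sinh_nonneg_iff.2 ha),
      Real.cosh_pos (c + a - (a + b))]
  rw [one_sub_exp_logRatio, Real.tanh_eq_sinh_div_cosh, Real.tanh_eq_sinh_div_cosh,
    div_mul_div_comm, div_div, mul_comm _ 2]
  exact div_le_div_of_nonneg_left
    (mul_nonneg (Real.sinh_nonneg_iff.2 hca) (Real.sinh_nonneg_iff.2 hab))
    (mul_pos (Real.cosh_pos _) (Real.cosh_pos _)) hcosh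

end LogCosh

theorem abs_log_hexWeight_base_le (r : Fin 3 → ℝ) (k : Fin 3) :
    |Real.log (Real.cosh (r k) * Real.cosh (r (k + 1)) * Real.cosh (r (k + 2)) /
      Real.cosh (r k + r (k + 1) + r (k + 2)))| ≤ 2 * (|r (k + 1)| + |r (k + 2)|) := by
  have hne (x : ℝ) := (Real.cosh_pos x).ne'
  have hle := log_cosh_add_le (r k) (r (k + 1) + r (k + 2))
  have hge := log_cosh_add_le (r k + r (k + 1) + r (k + 2)) (-(r (k + 1) + r (k + 2)))
  rw [← add_assoc] at hle
  rw [abs_neg, add_assoc (r k), add_neg_cancel_right, ← add_assoc] at hge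
  rw [Real.log_div (mul_ne_zero (mul_ne_zero (hne _) (hne _)) (hne _)) (hne _),
    Real.log_mul (mul_ne_zero (hne _) (hne _)) (hne _), Real.log_mul (hne _) (hne _), abs_le]
  have hadd := abs_add_le (r (k + 1)) (r (k + 2))
  constructor <;> linarith [log_cosh_nonneg (r (k + 1)), log_cosh_nonneg (r (k + 2)),
    log_cosh_le_abs (r (k + 1)), log_cosh_le_abs (r (k + 2))]

theorem le_hexWeight (lam : ℝ) (r : Fin 3 → ℝ) (k : Fin 3) :
    Real.exp (-(2 * (|r (k + 1)| + |r (k + 2)|) * |1 + lam / 2|)) ≤ hexWeight lam r := by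
  have hpos : 0 < Real.cosh (r k) * Real.cosh (r (k + 1)) * Real.cosh (r (k + 2)) /
      Real.cosh (r k + r (k + 1) + r (k + 2)) := by
    positivity
  rw [hexWeight_eq lam r k, Real.rpow_def_of_pos hpos, Real.exp_le_exp]
  refine (neg_le_neg ?_).trans (neg_abs_le _)
  rw [abs_mul]
  exact mul_le_mul_of_nonneg_right (abs_log_hexWeight_base_le r k) (abs_nonneg _)

section CoshInv

variable {lam x y W : ℝ}

theorem abs_lt_abs_of_notMem_range (hx : x ∈ Set.range (coshPrimitive lam))
    (hy : y ∉ Set.range (coshPrimitive lam)) : |x| < |y| := by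
  rw [mem_range_coshPrimitive] at hx hy
  exact (ENNReal.ofReal_lt_ofReal_iff'.1 (hx.trans_le (not_lt.1 hy))).1

theorem lam_neg_of_notMem_range (hy : y ∉ Set.range (coshPrimitive lam)) : lam < 0 := by
  by_contra h
  rw [mem_range_coshPrimitive, coshIntegral_of_nonneg (not_lt.1 h)] at hy
  exact hy ENNReal.ofReal_lt_top

theorem neg_mem_range_iff :
    -x ∈ Set.range (coshPrimitive lam) ↔ x ∈ Set.range (coshPrimitive lam) := by
  rw [mem_range_coshPrimitive, mem_range_coshPrimitive, abs_neg]

theorem coshInv_neg (hx : x ∈ Set.range (coshPrimitive lam)) :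
    coshInv lam (-x) = -coshInv lam x := by
  obtain ⟨r, rfl⟩ := hx
  rw [← coshPrimitive_neg, coshInv_coshPrimitive, coshInv_coshPrimitive]

theorem lt_coshInv_iff {r : ℝ} (hx : x ∈ Set.range (coshPrimitive lam)) :
    r < coshInv lam x ↔ coshPrimitive lam r < x := by
  obtain ⟨s, rfl⟩ := hx
  rw [coshInv_coshPrimitive, (strictMono_coshPrimitive lam).lt_iff_lt]

theorem coshPrimitive_lt_of_notMem_range (hW : W ∉ Set.range (coshPrimitive lam)) (hpos : 0 < W)
    (r : ℝ) : coshPrimitive lam r < W :=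
  (le_abs_self _).trans_lt ((abs_lt_abs_of_notMem_range ⟨r, rfl⟩ hW).trans_eq (abs_of_pos hpos))

theorem tendsto_coshInv_atTop {l : Filter ℝ} {f : ℝ → ℝ} (hW : W ∉ Set.range (coshPrimitive lam))
    (hpos : 0 < W) (hf : Tendsto f l (𝓝 W))
    (hmem : ∀ᶠ τ in l, f τ ∈ Set.range (coshPrimitive lam)) :
    Tendsto (fun τ => coshInv lam (f τ)) l atTop := by
  refine tendsto_atTop.2 fun M => ?_
  filter_upwards [hf.eventually_const_lt (coshPrimitive_lt_of_notMem_range hW hpos M), hmem]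
    with τ hlt hτ
  exact ((lt_coshInv_iff hτ).2 hlt).le

theorem coshPrimitive_sub_le (hlam : lam ≤ 0) (hx : 0 ≤ x) (hxy : x ≤ y) :
    coshPrimitive lam y - coshPrimitive lam x ≤ Real.cosh x ^ lam * (y - x) := by
  refine Convex.image_sub_le_mul_sub_of_deriv_le (convex_Ici x)
    (continuous_coshPrimitive lam).continuousOn
    (fun t _ => (hasDerivAt_coshPrimitive lam t).differentiableAt.differentiableWithinAt)
    (fun t ht => ?_) x Set.self_mem_Ici y hxy hxy
  rw [interior_Ici] at ht
  rw [(hasDerivAt_coshPrimitive lam t).deriv]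
  refine Real.rpow_le_rpow_of_nonpos (Real.cosh_pos _) (Real.cosh_le_cosh.2 ?_) hlam
  exact abs_le_abs_of_nonneg hx (le_of_lt ht)

theorem monotone_cosh_rpow_sub (hlam : lam ≤ 0) :
    Monotone fun x => Real.cosh x ^ lam - lam * coshPrimitive lam x := by
  refine monotone_of_hasDerivAt_nonneg (fun x =>
    ((Real.hasDerivAt_cosh x).rpow_const (Or.inl (Real.cosh_pos x).ne')).sub
      ((hasDerivAt_coshPrimitive lam x).const_mul lam)) fun x => ?_
  have hpow : Real.cosh x ^ lam = Real.cosh x ^ (lam - 1) * Real.cosh x := by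
    rw [Real.rpow_sub_one (Real.cosh_pos x).ne', div_mul_cancel₀ _ (Real.cosh_pos x).ne']
  calc 0 ≤ -lam * (Real.cosh x - Real.sinh x) * Real.cosh x ^ (lam - 1) :=
        mul_nonneg (mul_nonneg (neg_nonneg.2 hlam) (sub_nonneg.2 (Real.sinh_lt_cosh x).le))
          (cosh_rpow_pos _ x).le
    _ = Real.sinh x * lam * Real.cosh x ^ (lam - 1) - lam * Real.cosh x ^ lam := by
        rw [hpow]
        ring

theorem tendsto_cosh_rpow_atTop (hlam : lam < 0) :
    Tendsto (fun x => Real.cosh x ^ lam) atTop (𝓝 0) := by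
  have hcosh : Tendsto Real.cosh atTop atTop :=
    tendsto_atTop_mono (fun x => by
      rw [Real.cosh_eq, id]
      linarith [Real.add_one_le_exp x, Real.exp_pos (-x)]) (tendsto_id.atTop_div_const zero_lt_two)
  simpa only [neg_neg, Function.comp_def] using (tendsto_rpow_neg_atTop (neg_pos.2 hlam)).comp hcosh

/-- The tail estimate `cosh x ^ lam ≤ -lam * ∫ₓ^∞ cosh ^ lam`. -/
theorem cosh_rpow_le_of_notMem_range (hW : W ∉ Set.range (coshPrimitive lam)) (hpos : 0 < W)
    (x : ℝ) : Real.cosh x ^ lam ≤ -lam * (W - coshPrimitive lam x) := by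
  have hlam := lam_neg_of_notMem_range hW
  have hlim := (tendsto_cosh_rpow_atTop hlam).const_sub (Real.cosh x ^ lam)
  rw [sub_zero] at hlim
  refine le_of_tendsto hlim ((eventually_ge_atTop x).mono fun y hxy => ?_)
  have hmono := monotone_cosh_rpow_sub hlam.le hxy
  have hW' := mul_le_mul_of_nonneg_left (coshPrimitive_lt_of_notMem_range hW hpos y).le
    (neg_pos.2 hlam).le
  dsimp only at hmono
  linarith

theorem div_le_coshInv_add_coshInv (hW : W ∉ Set.range (coshPrimitive lam)) (hpos : 0 < W)
    (hx : x ∈ Set.range (coshPrimitive lam)) (hy : y ∈ Set.range (coshPrimitive lam)) (hx0 : x ≤ 0)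
    (hxy : 0 < x + y) : (x + y) / (-lam * (W + x)) ≤ coshInv lam x + coshInv lam y := by
  have hlam := lam_neg_of_notMem_range hW
  obtain ⟨a, rfl⟩ := hx
  obtain ⟨b, rfl⟩ := hy
  rw [coshInv_coshPrimitive, coshInv_coshPrimitive]
  have ha : 0 ≤ -a := by
    rwa [← coshPrimitive_zero lam, (strictMono_coshPrimitive lam).le_iff_le, ← neg_nonneg] at hx0
  have hab : -a < b := by
    rwa [← neg_lt_iff_pos_add', ← coshPrimitive_neg,
      (strictMono_coshPrimitive lam).lt_iff_lt] at hxy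
  have hWa : 0 < W + coshPrimitive lam a := by
    linarith [coshPrimitive_lt_of_notMem_range hW hpos (-a), coshPrimitive_neg lam a]
  rw [div_le_iff₀ (mul_pos (neg_pos.2 hlam) hWa)]
  calc coshPrimitive lam a + coshPrimitive lam b
      = coshPrimitive lam b - coshPrimitive lam (-a) := by rw [coshPrimitive_neg]; ring
    _ ≤ Real.cosh (-a) ^ lam * (b - -a) := coshPrimitive_sub_le hlam.le ha hab.le
    _ ≤ -lam * (W - coshPrimitive lam (-a)) * (b - -a) :=
        mul_le_mul_of_nonneg_right (cosh_rpow_le_of_notMem_range hW hpos _) (sub_pos.2 hab).le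
    _ = (a + b) * (-lam * (W + coshPrimitive lam a)) := by rw [coshPrimitive_neg]; ring

end CoshInv

theorem tendsto_atTop_of_deriv_le_div {f f' : ℝ → ℝ} {c δ : ℝ} (hc : 0 < c) (hδ : 0 < δ)
    (hf : ∀ τ ∈ Set.Ioo 0 δ, HasDerivAt f (f' τ) τ) (hf' : ∀ τ ∈ Set.Ioo 0 δ, f' τ ≤ -(c / τ)) :
    Tendsto f (𝓝[>] 0) atTop := by
  have hderiv (τ) (hτ : τ ∈ Set.Ioo 0 δ) : HasDerivAt (fun τ => f τ + c * Real.log τ)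
      (f' τ + c * τ⁻¹) τ := (hf τ hτ).add ((Real.hasDerivAt_log hτ.1.ne').const_mul c)
  have hanti : AntitoneOn (fun τ => f τ + c * Real.log τ) (Set.Ioo 0 δ) := by
    refine antitoneOn_of_hasDerivWithinAt_nonpos (convex_Ioo 0 δ)
      (fun τ hτ => (hderiv τ hτ).continuousAt.continuousWithinAt)
      (fun τ hτ => (hderiv τ (interior_subset hτ)).hasDerivWithinAt) fun τ hτ => ?_
    linarith [hf' τ (interior_subset hτ), div_eq_mul_inv c τ]
  have hm : δ / 2 ∈ Set.Ioo 0 δ := ⟨half_pos hδ, half_lt_self hδ⟩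
  refine tendsto_atTop_mono' _ ?_ (tendsto_atTop_add_const_left _
    (f (δ / 2) + c * Real.log (δ / 2))
    (tendsto_neg_atBot_atTop.comp (Real.tendsto_log_nhdsGT_zero.const_mul_atBot hc)))
  filter_upwards [Ioo_mem_nhdsGT hm.1] with τ hτ
  have hle := hanti ⟨hτ.1, hτ.2.trans hm.2⟩ hm hτ.2.le
  dsimp only [Function.comp] at hle ⊢
  linarith

theorem tanh_le_tanh {x y : ℝ} (h : x ≤ y) : Real.tanh x ≤ Real.tanh y := by
  rw [Real.tanh_eq_sinh_div_cosh, Real.tanh_eq_sinh_div_cosh,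
    div_le_div_iff₀ (Real.cosh_pos x) (Real.cosh_pos y)]
  linarith [Real.sinh_sub y x, Real.sinh_nonneg_iff.2 (sub_nonneg.2 h)]

theorem tanh_pos {x : ℝ} (h : 0 < x) : 0 < Real.tanh x := by
  rw [Real.tanh_eq_sinh_div_cosh]
  exact div_pos (Real.sinh_pos_iff.2 h) (Real.cosh_pos x)

theorem sideLog_le {r : Fin 3 → ℝ} {i : Fin 3} {δ : ℝ} (hr : r ∈ coordCone) (hi : 0 ≤ r i)
    (hδ : 0 < δ) (hprev : δ ≤ r (i + 2) + r i) (hnext : δ ≤ r i + r (i + 1)) :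
    sideLog r i ≤ Real.log (1 - Real.tanh δ ^ 2 / 2) := by
  have htanh := Real.tanh_sq_lt_one δ
  have hmul : Real.tanh δ ^ 2 ≤ Real.tanh (r (i + 2) + r i) * Real.tanh (r i + r (i + 1)) := by
    rw [sq]
    exact mul_le_mul (tanh_le_tanh hprev) (tanh_le_tanh hnext) (tanh_pos hδ).le
      ((tanh_pos hδ).le.trans (tanh_le_tanh hprev))
  rw [Real.le_log_iff_exp_le (by linarith), sideLog]
  linarith [tanh_mul_tanh_le (b := r (i + 1)) (c := r (i + 2)) hi (by linarith [hr i])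
    (hδ.le.trans hprev) (hδ.le.trans hnext)]

section Ray

variable {lam : ℝ} {w d : Fin 3 → ℝ} {i j k : Fin 3}

theorem tendsto_ray (w d : Fin 3 → ℝ) (i : Fin 3) :
    Tendsto (fun τ : ℝ => (w + τ • d) i) (𝓝[>] 0) (𝓝 (w i)) := by
  simpa only [zero_smul, add_zero] using
    (hasDerivAt_ray w d i 0).continuousAt.tendsto.mono_left nhdsWithin_le_nhds

theorem eventually_mem_range (hray : ∀ᶠ τ in 𝓝[>] (0 : ℝ), w + τ • d ∈ weightCone lam)
    (i : Fin 3) : ∀ᶠ τ in 𝓝[>] (0 : ℝ), (w + τ • d) i ∈ Set.range (coshPrimitive lam) :=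
  hray.mono fun _ hτ => hτ.1 i

theorem dir_add_pos (hray : ∀ᶠ τ in 𝓝[>] (0 : ℝ), w + τ • d ∈ weightCone lam)
    (hk : w (k + 1) + w (k + 2) = 0) : 0 < d (k + 1) + d (k + 2) := by
  obtain ⟨τ, hτ, hpos⟩ := (hray.and self_mem_nhdsWithin).exists
  have hsum := hτ.2 k
  simp only [Pi.add_apply, Pi.smul_apply, smul_eq_mul] at hsum
  exact (mul_pos_iff_of_pos_left hpos).1 (by linarith)

theorem mul_dir_neg (hray : ∀ᶠ τ in 𝓝[>] (0 : ℝ), w + τ • d ∈ weightCone lam)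
    (hi : w i ∉ Set.range (coshPrimitive lam)) : w i * d i < 0 := by
  obtain ⟨τ, hτ, hpos⟩ := (hray.and self_mem_nhdsWithin).exists
  have hlt := sq_lt_sq.2 (abs_lt_abs_of_notMem_range (hτ.1 i) hi)
  simp only [Pi.add_apply, Pi.smul_apply, smul_eq_mul] at hlt
  exact (pos_iff_neg_of_mul_neg (by nlinarith [sq_nonneg (τ * d i)] : τ * (w i * d i) < 0)).1 hpos

theorem tendsto_coords (d : Fin 3 → ℝ) (hi : w i ∈ Set.range (coshPrimitive lam)) :
    Tendsto (fun τ : ℝ => coords lam (w + τ • d) i) (𝓝[>] 0) (𝓝 (coords lam w i)) :=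
  (hasDerivAt_coshInv hi).continuousAt.tendsto.comp (tendsto_ray w d i)

theorem tendsto_scaledDir (d : Fin 3 → ℝ) (hi : w i ∈ Set.range (coshPrimitive lam)) :
    Tendsto (fun τ : ℝ => scaledDir lam (w + τ • d) d i) (𝓝[>] 0) (𝓝 (scaledDir lam w d i)) :=
  (((continuous_cosh_rpow _).tendsto _).comp (tendsto_coords d hi)).mul_const _

theorem coords_opposite (hk : w (k + 1) + w (k + 2) = 0)
    (hmem : w (k + 1) ∈ Set.range (coshPrimitive lam)) :
    coords lam w (k + 2) = -coords lam w (k + 1) := by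
  rw [coords, coords, eq_neg_of_add_eq_zero_right hk, coshInv_neg hmem]

theorem eventually_sinhArc_le (hk : w (k + 1) + w (k + 2) = 0)
    (hmem : w (k + 1) ∈ Set.range (coshPrimitive lam)) :
    ∃ C > 0, ∀ᶠ τ in 𝓝[>] (0 : ℝ), sinhArc (coords lam (w + τ • d)) k ≤ C * τ := by
  have hmem' : w (k + 2) ∈ Set.range (coshPrimitive lam) :=
    eq_neg_of_add_eq_zero_right hk ▸ neg_mem_range_iff.2 hmem
  have hderiv {j : Fin 3} (hj : w j ∈ Set.range (coshPrimitive lam)) :=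
    hasDerivAt_coords (d := d) (τ := 0) (by rwa [zero_smul, add_zero])
  obtain ⟨C, hC, hbound⟩ := ((hderiv hmem).add (hderiv hmem')).sinh.isBigO_sub.exists_pos
  refine ⟨C, hC, ?_⟩
  filter_upwards [hbound.bound.filter_mono nhdsWithin_le_nhds, self_mem_nhdsWithin] with τ hτ hpos
  simp only [Pi.add_apply, zero_smul, add_zero, coords_opposite hk hmem, add_neg_cancel,
    Real.sinh_zero, sub_zero, Real.norm_eq_abs, abs_of_pos (Set.mem_Ioi.1 hpos)] at hτ
  exact (le_abs_self _).trans hτ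

theorem eventually_le_hexWeight_mul (hk : w (k + 1) + w (k + 2) = 0)
    (hmem : w (k + 1) ∈ Set.range (coshPrimitive lam)) (hd : 0 < d (k + 1) + d (k + 2)) :
    ∃ m > 0, ∀ᶠ τ in 𝓝[>] (0 : ℝ), m ≤ hexWeight lam (coords lam (w + τ • d)) *
      (scaledDir lam (w + τ • d) d (k + 1) + scaledDir lam (w + τ • d) d (k + 2)) ^ 2 := by
  have hmem' : w (k + 2) ∈ Set.range (coshPrimitive lam) :=
    eq_neg_of_add_eq_zero_right hk ▸ neg_mem_range_iff.2 hmem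
  have hdir : 0 < scaledDir lam w d (k + 1) + scaledDir lam w d (k + 2) := by
    rw [scaledDir, scaledDir, coords_opposite hk hmem, Real.cosh_neg, ← mul_add]
    exact mul_pos (cosh_rpow_pos _ _) hd
  have hlim := ((((tendsto_coords d hmem).abs.add (tendsto_coords d hmem').abs).const_mul
    2).mul_const |1 + lam / 2|).neg.rexp.mul
      (((tendsto_scaledDir d hmem).add (tendsto_scaledDir d hmem')).pow 2)
  obtain ⟨m, hm, hlt⟩ := exists_between (mul_pos (Real.exp_pos
    (-(2 * (|coords lam w (k + 1)| + |coords lam w (k + 2)|) * |1 + lam / 2|))) (pow_pos hdir 2))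
  exact ⟨m, hm, (hlim.eventually_const_lt hlt).mono fun τ hτ =>
    hτ.le.trans (mul_le_mul_of_nonneg_right (le_hexWeight lam _ k) (sq_nonneg _))⟩

/-- Where an arc shrinks to a point, the second derivative along the ray is of order `-1 / τ`, which
is not integrable. -/
theorem tendsto_sum_hexSlope_of_opposite
    (hray : ∀ᶠ τ in 𝓝[>] (0 : ℝ), w + τ • d ∈ weightCone lam) (hk : w (k + 1) + w (k + 2) = 0)
    (hmem : w (k + 1) ∈ Set.range (coshPrimitive lam)) :
    Tendsto (fun τ : ℝ => ∑ i, hexSlope lam (w + τ • d) i * d i) (𝓝[>] 0) atTop := by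
  obtain ⟨C, hC, harc⟩ := eventually_sinhArc_le (d := d) hk hmem
  obtain ⟨m, hm, hweight⟩ := eventually_le_hexWeight_mul hk hmem (dir_add_pos hray hk)
  have hbound : ∀ᶠ τ in 𝓝[>] (0 : ℝ), w + τ • d ∈ weightCone lam ∧
      hexHessian lam (coords lam (w + τ • d)) (scaledDir lam (w + τ • d) d)
        (scaledDir lam (w + τ • d) d) ≤ -(m / C / τ) := by
    filter_upwards [hray, harc, hweight] with τ hτ harcτ hweightτ
    refine ⟨hτ, (hexHessian_self_le lam (coords_mem hτ) _ k).trans (neg_le_neg ?_)⟩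
    rw [div_div, div_mul_eq_mul_div]
    exact div_le_div₀ (hm.le.trans hweightτ) hweightτ (sinhArc_pos k (coords_mem hτ)) harcτ
  obtain ⟨δ, hδ, hsub⟩ := mem_nhdsGT_iff_exists_Ioo_subset.1 hbound
  exact tendsto_atTop_of_deriv_le_div (div_pos hm hC) hδ
    (fun τ hτ => hasDerivAt_sum_hexSlope (hsub hτ).1 d) fun τ hτ => (hsub hτ).2

theorem tendsto_coords_atTop (hray : ∀ᶠ τ in 𝓝[>] (0 : ℝ), w + τ • d ∈ weightCone lam)
    (hi : w i ∉ Set.range (coshPrimitive lam)) (hpos : 0 < w i) :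
    Tendsto (fun τ : ℝ => coords lam (w + τ • d) i) (𝓝[>] 0) atTop :=
  tendsto_coshInv_atTop hi hpos (tendsto_ray w d i) (eventually_mem_range hray i)

theorem tendsto_coords_atBot (hray : ∀ᶠ τ in 𝓝[>] (0 : ℝ), w + τ • d ∈ weightCone lam)
    (hi : w i ∉ Set.range (coshPrimitive lam)) (hneg : w i < 0) :
    Tendsto (fun τ : ℝ => coords lam (w + τ • d) i) (𝓝[>] 0) atBot := by
  have hmem := eventually_mem_range hray i
  refine tendsto_neg_atTop_iff.1 ((tendsto_coshInv_atTop (mt neg_mem_range_iff.1 hi)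
    (neg_pos.2 hneg) (tendsto_ray w d i).neg (hmem.mono fun τ => neg_mem_range_iff.2)).congr' ?_)
  exact hmem.mono fun τ => coshInv_neg

/-- The length of the arc between two coordinates escaping to `-∞` and `∞` stays bounded below. -/
theorem eventually_le_coords_add (hray : ∀ᶠ τ in 𝓝[>] (0 : ℝ), w + τ • d ∈ weightCone lam)
    (hi : w i ∉ Set.range (coshPrimitive lam)) (hneg : w i < 0) (hj : w j = -w i)
    (hd : 0 < d i + d j) : ∀ᶠ τ in 𝓝[>] (0 : ℝ),
      (d i + d j) / (-lam * d i) ≤ coords lam (w + τ • d) i + coords lam (w + τ • d) j := by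
  filter_upwards [eventually_mem_range hray i, eventually_mem_range hray j, self_mem_nhdsWithin,
    (tendsto_ray w d i).eventually_lt_const hneg] with τ hτi hτj hτ hτneg
  have hsum : (w + τ • d) i + (w + τ • d) j = τ * (d i + d j) := by
    simp only [Pi.add_apply, Pi.smul_apply, smul_eq_mul, hj]
    ring
  have hle := div_le_coshInv_add_coshInv (mt neg_mem_range_iff.1 hi) (neg_pos.2 hneg) hτi hτj
    hτneg.le (hsum ▸ mul_pos hτ hd)
  rwa [hsum, Pi.add_apply, neg_add_cancel_left, Pi.smul_apply, smul_eq_mul, mul_left_comm,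
    mul_div_mul_left _ _ (ne_of_gt hτ)] at hle

theorem tendsto_hexSlope_atTop (hray : ∀ᶠ τ in 𝓝[>] (0 : ℝ), w + τ • d ∈ weightCone lam)
    (hi : Tendsto (fun τ : ℝ => coords lam (w + τ • d) i) (𝓝[>] 0) atBot) :
    Tendsto (fun τ : ℝ => hexSlope lam (w + τ • d) i) (𝓝[>] 0) atTop := by
  have hneg := hray.mono fun τ hτ => sideLog_neg (coords_mem hτ) i
  have hlow := ((Real.tendsto_exp_atBot.comp (hi.const_mul_atBot two_pos)).const_mul 2).neg
  rw [mul_zero, neg_zero] at hlow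
  refine (tendsto_slope_zero lam).comp (tendsto_nhdsWithin_iff.2 ⟨?_, hneg⟩)
  refine tendsto_of_tendsto_of_tendsto_of_le_of_le' hlow tendsto_const_nhds ?_
    (hneg.mono fun τ hτ => hτ.le)
  filter_upwards [hray] with τ hτ
  exact neg_two_mul_exp_le_logRatio (coordCone_next (coords_mem hτ) i).1
    (coordCone_next (coords_mem hτ) i).2

theorem eventually_hexSlope_le {δ : ℝ} (hδ : 0 < δ)
    (hray : ∀ᶠ τ in 𝓝[>] (0 : ℝ), w + τ • d ∈ weightCone lam)
    (hi : Tendsto (fun τ : ℝ => coords lam (w + τ • d) i) (𝓝[>] 0) atTop)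
    (hprev : ∀ᶠ τ in 𝓝[>] (0 : ℝ),
      δ ≤ coords lam (w + τ • d) (i + 2) + coords lam (w + τ • d) i)
    (hnext : ∀ᶠ τ in 𝓝[>] (0 : ℝ),
      δ ≤ coords lam (w + τ • d) i + coords lam (w + τ • d) (i + 1)) :
    ∃ M, ∀ᶠ τ in 𝓝[>] (0 : ℝ), hexSlope lam (w + τ • d) i ≤ M := by
  have htanh := Real.tanh_sq_lt_one δ
  have hneg : Real.log (1 - Real.tanh δ ^ 2 / 2) < 0 :=
    Real.log_neg (by linarith) (by linarith [pow_pos (tanh_pos hδ) 2])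
  refine ⟨slope lam (Real.log (1 - Real.tanh δ ^ 2 / 2)), ?_⟩
  filter_upwards [hray, hi.eventually_ge_atTop 0, hprev, hnext] with τ hτ h0 hprevτ hnextτ
  exact (slope_strictMonoOn lam).monotoneOn (sideLog_neg (coords_mem hτ) i) hneg
    (sideLog_le (coords_mem hτ) h0 hδ hprevτ hnextτ)

theorem tendsto_sum_hexSlope_of_corner
    (hray : ∀ᶠ τ in 𝓝[>] (0 : ℝ), w + τ • d ∈ weightCone lam)
    (hi : w i ∉ Set.range (coshPrimitive lam)) (hneg : w i < 0)
    (hnext : w (i + 1) = -w i) (hprev : w (i + 2) = -w i) :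
    Tendsto (fun τ : ℝ => ∑ j, hexSlope lam (w + τ • d) j * d j) (𝓝[>] 0) atTop := by
  obtain ⟨h11, h12, h21, h22⟩ := fin_three_add_add i
  have hlam := lam_neg_of_notMem_range hi
  have hdir : 0 < d i := pos_of_mul_neg_right (mul_dir_neg hray hi) hneg.le
  have hatTop {j : Fin 3} (hj : w j = -w i) :
      d j < 0 ∧ Tendsto (fun τ : ℝ => coords lam (w + τ • d) j) (𝓝[>] 0) atTop := by
    have hmem : w j ∉ Set.range (coshPrimitive lam) := hj ▸ mt neg_mem_range_iff.1 hi
    have hpos : 0 < w j := hj ▸ neg_pos.2 hneg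
    exact ⟨neg_of_mul_neg_right (mul_dir_neg hray hmem) hpos.le,
      tendsto_coords_atTop hray hmem hpos⟩
  have hlong {j : Fin 3} (hj : w j = -w i) (hd : 0 < d i + d j) :
      ∃ δ > 0, ∀ᶠ τ in 𝓝[>] (0 : ℝ), δ ≤ coords lam (w + τ • d) i + coords lam (w + τ • d) j :=
    ⟨_, div_pos hd (mul_pos (neg_pos.2 hlam) hdir), eventually_le_coords_add hray hi hneg hj hd⟩
  have hfar := (hatTop hnext).2.atTop_add_atTop (hatTop hprev).2
  obtain ⟨δ, hδ, hδle⟩ := hlong hnext (by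
    have h := dir_add_pos (k := i + 2) hray (by rw [h21, h22, hnext, add_neg_cancel])
    rwa [h21, h22] at h)
  obtain ⟨δ', hδ', hδle'⟩ := hlong hprev (by
    have h := dir_add_pos (k := i + 1) hray (by rw [h11, h12, hprev, neg_add_cancel])
    rwa [h11, h12, add_comm] at h)
  obtain ⟨M, hM⟩ := eventually_hexSlope_le hδ hray (hatTop hnext).2 (by rwa [h12])
    (by rw [h11]; exact hfar.eventually_ge_atTop δ)
  obtain ⟨M', hM'⟩ := eventually_hexSlope_le hδ' hray (hatTop hprev).2
    (by rw [h22]; exact hfar.eventually_ge_atTop δ') (by simpa only [h21, add_comm] using hδle')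
  refine tendsto_atTop_mono' _ ?_ (tendsto_atTop_add_const_right _ (M * d (i + 1) + M' * d (i + 2))
    ((tendsto_hexSlope_atTop hray (tendsto_coords_atBot hray hi hneg)).atTop_mul_const hdir))
  filter_upwards [hM, hM'] with τ hτ hτ'
  rw [sum_fin_three _ i, add_assoc]
  exact add_le_add_right (add_le_add (mul_le_mul_of_nonpos_right hτ (hatTop hnext).1.le)
    (mul_le_mul_of_nonpos_right hτ' (hatTop hprev).1.le)) _

theorem tendsto_sum_hexSlope (hray : ∀ᶠ τ in 𝓝[>] (0 : ℝ), w + τ • d ∈ weightCone lam)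
    (hcl : ∀ i, ENNReal.ofReal |w i| ≤ coshIntegral lam)
    (hnn : ∀ i, 0 ≤ w (i + 1) + w (i + 2)) (hk : w (k + 1) + w (k + 2) = 0) :
    Tendsto (fun τ : ℝ => ∑ i, hexSlope lam (w + τ • d) i * d i) (𝓝[>] 0) atTop := by
  by_cases hmem : w (k + 1) ∈ Set.range (coshPrimitive lam)
  · exact tendsto_sum_hexSlope_of_opposite hray hk hmem
  obtain ⟨h11, h12, h21, h22⟩ := fin_three_add_add k
  have hle : |w k| ≤ |w (k + 1)| := by
    rw [mem_range_coshPrimitive, not_lt] at hmem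
    exact (ENNReal.ofReal_le_ofReal_iff (abs_nonneg _)).1 ((hcl k).trans hmem)
  have hne : w (k + 1) ≠ 0 := fun h0 => hmem ⟨0, by rw [h0, coshPrimitive_zero]⟩
  have hnn₁ := hnn (k + 1)
  have hnn₂ := hnn (k + 2)
  rw [h11, h12] at hnn₁
  rw [h21, h22] at hnn₂
  rcases lt_or_gt_of_ne hne with hneg | hpos
  · rw [abs_of_neg hneg, abs_le] at hle
    exact tendsto_sum_hexSlope_of_corner hray hmem hneg (by rw [h11]; linarith)
      (by rw [h12]; linarith)
  · rw [abs_of_pos hpos, abs_le] at hle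
    exact tendsto_sum_hexSlope_of_corner (i := k + 2) hray
      (by rwa [eq_neg_of_add_eq_zero_right hk, neg_mem_range_iff]) (by linarith)
      (by rw [h21]; linarith) (by rw [h22]; linarith)

theorem eventually_le_coords {m : ℝ} (hray : ∀ᶠ τ in 𝓝[>] (0 : ℝ), w + τ • d ∈ weightCone lam)
    (hm : coshPrimitive lam m < w i) : ∀ᶠ τ in 𝓝[>] (0 : ℝ), m ≤ coords lam (w + τ • d) i := by
  filter_upwards [(tendsto_ray w d i).eventually_const_lt hm, eventually_mem_range hray i]
    with τ hlt hτ
  exact ((lt_coshInv_iff hτ).2 hlt).le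

theorem tendsto_sideLog_atBot (hray : ∀ᶠ τ in 𝓝[>] (0 : ℝ), w + τ • d ∈ weightCone lam)
    (hi : w i ∉ Set.range (coshPrimitive lam))
    (hcl : ENNReal.ofReal |w i| ≤ coshIntegral lam) (hlow : ∀ j, -w i < w j) :
    Tendsto (fun τ : ℝ => sideLog (coords lam (w + τ • d)) i) (𝓝[>] 0) atBot := by
  have hpos : 0 < w i := neg_lt_self_iff.1 (hlow i)
  have hbelow (j : Fin 3) : ∃ m, coshPrimitive lam m < w j := by
    obtain ⟨y, hy, hyw⟩ := exists_between (lt_min (hlow j) (neg_lt_zero.2 hpos))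
    rw [lt_min_iff] at hyw
    have hmem : y ∈ Set.range (coshPrimitive lam) := by
      rw [mem_range_coshPrimitive, abs_of_neg hyw.2]
      rw [abs_of_pos hpos] at hcl
      exact ((ENNReal.ofReal_lt_ofReal_iff hpos).2 (neg_lt.1 hy)).trans_le hcl
    obtain ⟨m, rfl⟩ := hmem
    exact ⟨m, hyw.1⟩
  obtain ⟨m₁, hm₁⟩ := hbelow (i + 1)
  obtain ⟨m₂, hm₂⟩ := hbelow (i + 2)
  refine tendsto_atBot_mono' _ ?_ (tendsto_atBot_add_const_left _
    (4 * max |m₁| |m₂| + 2 * Real.log 2) (tendsto_neg_atTop_atBot.comp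
      ((tendsto_coords_atTop hray hi hpos).const_mul_atTop two_pos)))
  filter_upwards [eventually_le_coords hray hm₁, eventually_le_coords hray hm₂] with τ h₁ h₂
  exact logRatio_le ((abs_nonneg m₁).trans (le_max_left _ |m₂|))
    ((neg_le.1 ((neg_le_abs m₁).trans (le_max_left _ _))).trans h₁)
    ((neg_le.1 ((neg_le_abs m₂).trans (le_max_right _ _))).trans h₂)

theorem exists_eventually_le_sideLog (hi : w i ∈ Set.range (coshPrimitive lam)) :
    ∃ c, ∀ᶠ τ in 𝓝[>] (0 : ℝ), c ≤ sideLog (coords lam (w + τ • d)) i := by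
  refine ⟨-(2 * (|coords lam w i| + 1) + 2 * Real.log 2), ?_⟩
  filter_upwards [(tendsto_coords d hi).abs.eventually_lt_const (lt_add_one |coords lam w i|)]
    with τ hτ
  exact le_trans (by linarith) (le_logRatio _ _ _)

end Ray

/-! ### Maxima of quasiconcave functions on relatively open sets -/

theorem smul_add_smul_eq_add_smul_sub {E : Type*} [AddCommGroup E] [Module ℝ E] {a b : ℝ}
    (hab : a + b = 1) (x y : E) : a • x + b • y = x + b • (y - x) := by
  rw [eq_sub_of_add_eq hab]
  module

section QuasiconcaveMaximum

variable {E : Type*} [TopologicalSpace E] {P : Set E} {F : E → ℝ}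

theorem le_of_mem_closure_superlevel (hcont : ContinuousOn F P) {x : E} {c : ℝ} (hxP : x ∈ P)
    (hx : x ∈ closure {q ∈ P | c ≤ F q}) : c ≤ F x :=
  ContinuousWithinAt.closure_le hx continuousWithinAt_const
    ((hcont x hxP).mono fun _ hq => hq.1) fun _ hq => hq.2

theorem exists_forall_mem_closure_superlevel (hP : IsCompact (closure P)) (hne : P.Nonempty) :
    ∃ x ∈ closure P, ∀ p ∈ P, x ∈ closure {q ∈ P | F p ≤ F q} := by
  have hsub (p : P) : closure {q ∈ P | F p ≤ F q} ⊆ closure P := closure_mono fun _ hq => hq.1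
  have hdir : Directed (· ⊇ ·) fun p : P => closure {q ∈ P | F p ≤ F q} := fun p q =>
    (le_total (F p) (F q)).elim
      (fun hpq => ⟨q, closure_mono fun _ h => ⟨h.1, hpq.trans h.2⟩, subset_rfl⟩)
      (fun hqp => ⟨p, subset_rfl, closure_mono fun _ h => ⟨h.1, hqp.trans h.2⟩⟩)
  have : Nonempty P := hne.to_subtype
  obtain ⟨x, hx⟩ := IsCompact.nonempty_iInter_of_directed_nonempty_isCompact_isClosed _ hdir
    (fun p => ⟨p, subset_closure ⟨p.2, le_rfl⟩⟩)
    (fun p => hP.of_isClosed_subset isClosed_closure (hsub p)) fun _ => isClosed_closure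
  rw [Set.mem_iInter] at hx
  exact ⟨x, hsub _ (hx (Classical.arbitrary P)), fun p hp => hx ⟨p, hp⟩⟩

variable [AddCommGroup E] [Module ℝ E] [IsTopologicalAddGroup E] [ContinuousConstSMul ℝ E]

theorem add_smul_sub_mem_closure_superlevel (hF : QuasiconcaveOn ℝ P F) {x y : E} {c τ : ℝ}
    (hx : x ∈ closure {q ∈ P | c ≤ F q}) (hyP : y ∈ P) (hy : c ≤ F y)
    (hτ : τ ∈ Set.Icc (0 : ℝ) 1) : x + τ • (y - x) ∈ closure {q ∈ P | c ≤ F q} :=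
  map_mem_closure (f := fun q => q + τ • (y - q)) (by fun_prop) hx
    fun _ hq => (hF c).add_smul_sub_mem hq ⟨hyP, hy⟩ hτ

theorem exists_isMaxOn_of_lt_at_boundary (hP : IsCompact (closure P)) (hne : P.Nonempty)
    (hF : QuasiconcaveOn ℝ P F) (hcont : ContinuousOn F P)
    (hbd : ∀ x ∈ closure P, x ∉ P → ∃ y ∈ P, ∃ τ ∈ Set.Icc (0 : ℝ) 1,
      x + τ • (y - x) ∈ P ∧ F (x + τ • (y - x)) < F y) :
    ∃ x ∈ P, IsMaxOn F P x := by
  obtain ⟨x, hxcl, hx⟩ := exists_forall_mem_closure_superlevel (F := F) hP hne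
  by_cases hxP : x ∈ P
  · exact ⟨x, hxP, fun y hy => le_of_mem_closure_superlevel hcont hxP (hx y hy)⟩
  · obtain ⟨y, hy, τ, hτ, hmem, hlt⟩ := hbd x hxcl hxP
    have hcl := add_smul_sub_mem_closure_superlevel hF (hx y hy) hy le_rfl hτ
    exact absurd hlt (le_of_mem_closure_superlevel hcont hmem hcl).not_gt

end QuasiconcaveMaximum

/-! ### The potential of a triangulated surface -/

section Potential

variable {ι : Type*}

/-- The values of a function of the red sides on the red sides of the hexagon `h`. -/
def row (w : ι × Fin 3 → ℝ) (h : ι) : Fin 3 → ℝ := fun i => w (h, i)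

theorem continuous_row (h : ι) : Continuous fun w : ι × Fin 3 → ℝ => row w h :=
  continuous_pi fun _ => continuous_apply _

/-- The slope of the potential along the weight of the red side `s`. -/
def sideSlope (lam : ℝ) (w : ι × Fin 3 → ℝ) (s : ι × Fin 3) : ℝ := hexSlope lam (row w s.1) s.2

variable [Fintype ι]

/-- The sum of the potentials of the hexagons. -/
def potential (lam : ℝ) (w : ι × Fin 3 → ℝ) : ℝ := ∑ h, hexPotential lam (row w h)

/-- The derivative of `potential` in the direction `d`. -/
def potentialSlope (lam : ℝ) (w d : ι × Fin 3 → ℝ) : ℝ := ∑ s, sideSlope lam w s * d s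

theorem potentialSlope_eq (lam : ℝ) (w d : ι × Fin 3 → ℝ) : potentialSlope lam w d =
    ∑ h, ∑ i, hexSlope lam (row w h) i * row d h i := Fintype.sum_prod_type _

theorem potentialSlope_single_sub [DecidableEq ι] (lam : ℝ) (w : ι × Fin 3 → ℝ)
    (s t : ι × Fin 3) :
    potentialSlope lam w (Pi.single s 1 - Pi.single t 1) =
      sideSlope lam w s - sideSlope lam w t := by
  simp [potentialSlope, mul_sub, Finset.sum_sub_distrib, Pi.single_apply]

theorem hasDerivAt_potential {lam : ℝ} {w d : ι × Fin 3 → ℝ} {τ : ℝ}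
    (hw : ∀ h, row (w + τ • d) h ∈ weightCone lam) :
    HasDerivAt (fun t : ℝ => potential lam (w + t • d)) (potentialSlope lam (w + τ • d) d) τ := by
  rw [potentialSlope_eq]
  exact HasDerivAt.fun_sum fun h _ => hasDerivAt_hexPotential (hw h)

theorem antitoneOn_potentialSlope {lam : ℝ} {w d : ι × Fin 3 → ℝ} {s : Set ℝ} (hs : Convex ℝ s)
    (hw : ∀ τ ∈ s, ∀ h, row (w + τ • d) h ∈ weightCone lam) :
    AntitoneOn (fun t : ℝ => potentialSlope lam (w + t • d) d) s := by
  intro a ha b hb hab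
  simp only [potentialSlope_eq]
  exact Finset.sum_le_sum fun h _ =>
    antitoneOn_sum_hexSlope hs (fun τ hτ => hw τ hτ h) ha hb hab

theorem continuousOn_potential (lam : ℝ) :
    ContinuousOn (potential lam) {w : ι × Fin 3 → ℝ | ∀ h, row w h ∈ weightCone lam} :=
  continuousOn_finsetSum _ fun h _ => (continuousOn_hexPotential lam).comp
    (continuous_row h).continuousOn fun _ hw => hw h

theorem concaveOn_potential_segment {lam : ℝ} {x d : ι × Fin 3 → ℝ}
    (hw : ∀ τ ∈ Set.Icc (0 : ℝ) 1, ∀ h, row (x + τ • d) h ∈ weightCone lam) :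
    ConcaveOn ℝ (Set.Icc (0 : ℝ) 1) fun τ : ℝ => potential lam (x + τ • d) := by
  have hder (τ : ℝ) (hτ : τ ∈ Set.Icc (0 : ℝ) 1) := hasDerivAt_potential (hw τ hτ)
  refine AntitoneOn.concaveOn_of_deriv (convex_Icc 0 1)
    (fun τ hτ => (hder τ hτ).continuousAt.continuousWithinAt)
    (fun τ hτ => (hder τ (interior_subset hτ)).differentiableAt.differentiableWithinAt) ?_
  intro s hs t ht hst
  rw [(hder s (interior_subset hs)).deriv, (hder t (interior_subset ht)).deriv]
  exact antitoneOn_potentialSlope (convex_Icc 0 1) hw (interior_subset hs) (interior_subset ht) hst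

theorem concaveOn_potential {lam : ℝ} {P : Set (ι × Fin 3 → ℝ)} (hP : Convex ℝ P)
    (hw : ∀ w ∈ P, ∀ h, row w h ∈ weightCone lam) : ConcaveOn ℝ P (potential lam) := by
  refine ⟨hP, fun x hx y hy a b ha hb hab => ?_⟩
  have hconc := concaveOn_potential_segment fun τ hτ => hw _ (hP.add_smul_sub_mem hx hy hτ)
  simpa [smul_add_smul_eq_add_smul_sub hab] using
    hconc.2 (Set.left_mem_Icc.2 zero_le_one) (Set.right_mem_Icc.2 zero_le_one) ha hb hab

theorem exists_strictMonoOn_potential {lam : ℝ} {x d : ι × Fin 3 → ℝ}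
    (hray : ∀ᶠ τ in 𝓝[>] (0 : ℝ), ∀ h, row (x + τ • d) h ∈ weightCone lam)
    (hpos : ∀ᶠ τ in 𝓝[>] (0 : ℝ), 0 < potentialSlope lam (x + τ • d) d) :
    ∃ δ > 0, StrictMonoOn (fun τ : ℝ => potential lam (x + τ • d)) (Set.Ioo 0 δ) := by
  obtain ⟨δ, hδ, hsub⟩ := mem_nhdsGT_iff_exists_Ioo_subset.1 (hpos.and hray)
  refine ⟨δ, hδ, strictMonoOn_of_deriv_pos (convex_Ioo 0 δ)
    (fun τ hτ => (hasDerivAt_potential (hsub hτ).2).continuousAt.continuousWithinAt)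
    fun τ hτ => ?_⟩
  obtain ⟨hslope, hmem⟩ := hsub (interior_subset hτ)
  exact (hasDerivAt_potential hmem).deriv.symm ▸ hslope

theorem exists_potential_add_smul_sub_lt {lam : ℝ} {P : Set (ι × Fin 3 → ℝ)}
    (hP : ∀ w ∈ P, ∀ h, row w h ∈ weightCone lam) {x d : ι × Fin 3 → ℝ}
    (hray : ∀ᶠ τ in 𝓝[>] (0 : ℝ), x + τ • d ∈ P)
    (hpos : ∀ᶠ τ in 𝓝[>] (0 : ℝ), 0 < potentialSlope lam (x + τ • d) d) :
    ∃ y ∈ P, ∃ τ ∈ Set.Icc (0 : ℝ) 1,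
      x + τ • (y - x) ∈ P ∧ potential lam (x + τ • (y - x)) < potential lam y := by
  obtain ⟨δ, hδ, hmono⟩ :=
    exists_strictMonoOn_potential (hray.mono fun τ hτ => hP _ hτ) hpos
  obtain ⟨η, hη, hsub⟩ := mem_nhdsGT_iff_exists_Ioo_subset.1 hray
  obtain ⟨ε, hε, hlt⟩ := exists_between (lt_min hδ hη)
  obtain ⟨hεδ, hεη⟩ := lt_min_iff.1 hlt
  have hhalf : ε / 2 < ε := half_lt_self hε
  have heq : x + (1 / 2 : ℝ) • (x + ε • d - x) = x + (ε / 2) • d := by module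
  refine ⟨x + ε • d, hsub ⟨hε, hεη⟩, 1 / 2, ⟨by norm_num, by norm_num⟩, ?_⟩
  rw [heq]
  exact ⟨hsub ⟨half_pos hε, hhalf.trans hεη⟩,
    hmono ⟨half_pos hε, hhalf.trans hεδ⟩ ⟨hε, hεδ⟩ hhalf⟩

end Potential

/-! ### Existence of a metric with prescribed invariants -/

section WeightCone

variable {lam : ℝ} {w : Fin 3 → ℝ}

theorem add_pos_of_ne (hw : ∀ i, 0 < w (i + 1) + w (i + 2)) {i j : Fin 3} (hij : i ≠ j) :
    0 < w i + w j := by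
  obtain rfl | rfl : j = i + 1 ∨ j = i + 2 := by revert i j; decide
  · exact (coordCone_next hw i).2
  · exact add_comm (w (i + 2)) _ ▸ (coordCone_next hw i).1

theorem sum_pos_of_add_pos (hw : ∀ i, 0 < w (i + 1) + w (i + 2)) : 0 < ∑ i, w i := by
  rw [sum_fin_three w 0]
  linarith [hw 0, coordCone_next hw 0]

theorem abs_le_sum_of_add_pos (hw : ∀ i, 0 < w (i + 1) + w (i + 2)) (i : Fin 3) :
    |w i| ≤ ∑ j, w j := by
  obtain ⟨hprev, hnext⟩ := coordCone_next hw i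
  rw [sum_fin_three w i, abs_le]
  constructor <;> linarith [hw i]

theorem bounds_of_mem_closure_weightCone (hw : w ∈ closure (weightCone lam)) :
    (∀ i, ENNReal.ofReal |w i| ≤ coshIntegral lam) ∧ ∀ i, 0 ≤ w (i + 1) + w (i + 2) := by
  constructor <;> intro i
  · refine le_on_closure (f := fun w : Fin 3 → ℝ => ENNReal.ofReal |w i|)
      (fun w hw => (mem_range_coshPrimitive.1 (hw.1 i)).le) ?_ continuousOn_const hw
    exact (ENNReal.continuous_ofReal.comp (continuous_apply i).abs).continuousOn
  · exact le_on_closure (g := fun w : Fin 3 → ℝ => w (i + 1) + w (i + 2))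
      (fun w hw => (hw.2 i).le) continuousOn_const (by fun_prop) hw

theorem add_smul_sub_mem_weightCone {x y : Fin 3 → ℝ} {τ : ℝ}
    (hx : x ∈ closure (weightCone lam)) (hy : y ∈ weightCone lam) (hτ : τ ∈ Set.Ioc (0 : ℝ) 1) :
    x + τ • (y - x) ∈ weightCone lam := by
  have hint := (isOpen_weightCone lam).interior_eq
  have hmem := (convex_weightCone lam).add_smul_sub_mem_interior' hx (hint.symm ▸ hy) hτ
  rwa [hint] at hmem

theorem neg_lt_of_notMem_range (hcl : ∀ i, ENNReal.ofReal |w i| ≤ coshIntegral lam)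
    (hadd : ∀ i, 0 < w (i + 1) + w (i + 2)) {i : Fin 3}
    (hi : w i ∉ Set.range (coshPrimitive lam)) (j : Fin 3) : -w i < w j := by
  rcases eq_or_ne i j with rfl | hij
  · have hnext := (coordCone_next hadd i).2
    have hmax : |w (i + 1)| ≤ |w i| := by
      rw [mem_range_coshPrimitive, not_lt] at hi
      exact (ENNReal.ofReal_le_ofReal_iff (abs_nonneg _)).1 ((hcl (i + 1)).trans hi)
    by_contra! hneg
    have hnonpos : w i ≤ 0 := by linarith
    rw [abs_of_nonpos hnonpos] at hmax
    linarith [le_abs_self (w (i + 1))]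
  · exact neg_lt_iff_pos_add'.2 (add_pos_of_ne hadd hij)

theorem pos_of_notMem_range (hcl : ∀ i, ENNReal.ofReal |w i| ≤ coshIntegral lam)
    (hadd : ∀ i, 0 < w (i + 1) + w (i + 2)) {i : Fin 3}
    (hi : w i ∉ Set.range (coshPrimitive lam)) : 0 < w i :=
  neg_lt_self_iff.1 (neg_lt_of_notMem_range hcl hadd hi i)

end WeightCone

namespace IdealTriangulation

variable {ι : Type*} {T : IdealTriangulation ι} {lam : ℝ} {z : T.Edge → ℝ}

/-- The distributions of the edge invariants `z` over the red sides such that every hexagon can be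
realized. -/
def weights (T : IdealTriangulation ι) (lam : ℝ) (z : T.Edge → ℝ) : Set (ι × Fin 3 → ℝ) :=
  {w | (∀ h, row w h ∈ weightCone lam) ∧ ∀ s, w s + w (T.glue s) = z (T.edge s)}

theorem convex_weights : Convex ℝ (T.weights lam z) := by
  refine fun x hx y hy a b ha hb hab =>
    ⟨fun h => convex_weightCone lam (hx.1 h) (hy.1 h) ha hb hab, fun s => ?_⟩
  simp only [Pi.add_apply, Pi.smul_apply, smul_eq_mul]
  linear_combination a * hx.2 s + b * hy.2 s + z (T.edge s) * hab

theorem mem_closure_weights {x : ι × Fin 3 → ℝ} (hx : x ∈ closure (T.weights lam z)) :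
    (∀ h, row x h ∈ closure (weightCone lam)) ∧ ∀ s, x s + x (T.glue s) = z (T.edge s) := by
  refine ⟨fun h => map_mem_closure (f := fun w => row w h) (continuous_row h) hx
    fun w hw => hw.1 h, fun s => ?_⟩
  have hclosed : IsClosed {w : ι × Fin 3 → ℝ | w s + w (T.glue s) = z (T.edge s)} :=
    isClosed_eq (by fun_prop) continuous_const
  exact closure_minimal (fun w hw => hw.2 s) hclosed hx

theorem add_smul_sub_mem_weights {x y : ι × Fin 3 → ℝ} (hx : x ∈ closure (T.weights lam z))
    (hy : y ∈ T.weights lam z) {τ : ℝ} (hτ : τ ∈ Set.Ioc (0 : ℝ) 1) :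
    x + τ • (y - x) ∈ T.weights lam z := by
  obtain ⟨hcone, hedge⟩ := mem_closure_weights hx
  refine ⟨fun h => add_smul_sub_mem_weightCone (hcone h) (hy.1 h) hτ, fun s => ?_⟩
  simp only [Pi.add_apply, Pi.smul_apply, Pi.sub_apply, smul_eq_mul]
  linear_combination (1 - τ) * hedge s + τ * hy.2 s

/-- The gluing as a permutation of the red sides. -/
def glueEquiv (T : IdealTriangulation ι) : Equiv.Perm (ι × Fin 3) :=
  ⟨T.glue, T.glue, T.glue_glue, T.glue_glue⟩

theorem sum_glue [Fintype ι] {M : Type*} [AddCommMonoid M] (T : IdealTriangulation ι)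
    (f : ι × Fin 3 → M) : ∑ s, f (T.glue s) = ∑ s, f s := Equiv.sum_comp T.glueEquiv f

theorem two_mul_sum_weights [Fintype ι] {w : ι × Fin 3 → ℝ}
    (hw : ∀ s, w s + w (T.glue s) = z (T.edge s)) :
    2 * ∑ h, ∑ i, row w h i = ∑ s, z (T.edge s) := by
  simp only [row, ← Fintype.sum_prod_type', ← hw, Finset.sum_add_distrib, T.sum_glue w, two_mul]

theorem isCompact_closure_weights [Finite ι] : IsCompact (closure (T.weights lam z)) := by
  have := Fintype.ofFinite ι
  refine ((Metric.isBounded_closedBall (x := 0) (r := |(∑ s, z (T.edge s)) / 2|)).subset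
    fun w hw => ?_).isCompact_closure
  have hsum : ∑ h, ∑ i, row w h i = (∑ s, z (T.edge s)) / 2 := by
    linarith [two_mul_sum_weights hw.2]
  rw [mem_closedBall_zero_iff, pi_norm_le_iff_of_nonneg (abs_nonneg _), ← hsum]
  exact fun s => calc
    |w s| ≤ ∑ i, row w s.1 i := abs_le_sum_of_add_pos (hw.1 s.1).2 s.2
    _ ≤ ∑ h, ∑ i, row w h i := Finset.single_le_sum (f := fun h => ∑ i, row w h i)
      (fun h _ => (sum_pos_of_add_pos (hw.1 h).2).le) (Finset.mem_univ s.1)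
    _ ≤ _ := le_abs_self _

end IdealTriangulation

theorem eventually_sub_mem_range {lam x : ℝ} (hpos : 0 < x)
    (hcl : ENNReal.ofReal |x| ≤ coshIntegral lam) :
    ∀ᶠ ε in 𝓝[>] (0 : ℝ), x - ε ∈ Set.range (coshPrimitive lam) := by
  filter_upwards [Ioo_mem_nhdsGT hpos] with ε ⟨hε, hlt⟩
  refine mem_range_coshPrimitive.2 (lt_of_lt_of_le ?_ hcl)
  rw [ENNReal.ofReal_lt_ofReal_iff (abs_pos.2 hpos.ne'), abs_of_pos (sub_pos.2 hlt),
    abs_of_pos hpos]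
  exact sub_lt_self x hε

/-- The red sides whose weight lies at the boundary of the range of `coshPrimitive lam`. -/
def extremalSides {ι : Type*} (lam : ℝ) (x : ι × Fin 3 → ℝ) : Set (ι × Fin 3) :=
  {s | x s ∉ Set.range (coshPrimitive lam)}

namespace IdealTriangulation

variable {ι : Type*} {T : IdealTriangulation ι} {lam : ℝ} {z : T.Edge → ℝ}

/-- The direction in which all extremal weights decrease at unit speed and the edge invariants do
not change. -/
def inward (T : IdealTriangulation ι) (lam : ℝ) (x : ι × Fin 3 → ℝ) : ι × Fin 3 → ℝ := fun s =>
  (extremalSides lam x).indicator 1 (T.glue s) - (extremalSides lam x).indicator 1 s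

theorem inward_add_inward_glue (x : ι × Fin 3 → ℝ) (s : ι × Fin 3) :
    T.inward lam x s + T.inward lam x (T.glue s) = 0 := by
  simp only [inward, T.glue_glue]
  ring

theorem potentialSlope_inward [Fintype ι] (x w : ι × Fin 3 → ℝ) :
    potentialSlope lam w (T.inward lam x) = ∑ s, (extremalSides lam x).indicator
      (fun s => sideSlope lam w (T.glue s) - sideSlope lam w s) s := by
  have hswap := T.sum_glue fun s =>
    sideSlope lam w (T.glue s) * (extremalSides lam x).indicator 1 s
  simp only [T.glue_glue] at hswap
  simp only [potentialSlope, inward, mul_sub, Finset.sum_sub_distrib, hswap]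
  rw [← Finset.sum_sub_distrib]
  refine Finset.sum_congr rfl fun s _ => ?_
  by_cases hs : s ∈ extremalSides lam x <;> simp [hs]

variable {x y d : ι × Fin 3 → ℝ} {s t : ι × Fin 3}

theorem bounds_of_mem_closure_weights (hx : x ∈ closure (T.weights lam z)) (h : ι) :
    (∀ i, ENNReal.ofReal |row x h i| ≤ coshIntegral lam) ∧
      ∀ i, 0 ≤ row x h (i + 1) + row x h (i + 2) :=
  bounds_of_mem_closure_weightCone ((mem_closure_weights hx).1 h)

theorem pos_of_mem_extremalSides (hx : x ∈ closure (T.weights lam z))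
    (hadd : ∀ h i, 0 < row x h (i + 1) + row x h (i + 2)) (hs : s ∈ extremalSides lam x) :
    0 < x s :=
  pos_of_notMem_range (bounds_of_mem_closure_weights hx s.1).1 (hadd s.1) hs

theorem lt_of_mem_extremalSides (hx : x ∈ closure (T.weights lam z)) (hy : y ∈ T.weights lam z)
    (hadd : ∀ h i, 0 < row x h (i + 1) + row x h (i + 2)) (hs : s ∈ extremalSides lam x) :
    y s < x s := by
  rw [← abs_of_pos (pos_of_mem_extremalSides hx hadd hs)]
  exact (le_abs_self _).trans_lt (abs_lt_abs_of_notMem_range ((hy.1 s.1).1 s.2) hs)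

theorem glue_mem_range (hx : x ∈ closure (T.weights lam z)) (hy : y ∈ T.weights lam z)
    (hadd : ∀ h i, 0 < row x h (i + 1) + row x h (i + 2)) (hs : s ∈ extremalSides lam x) :
    x (T.glue s) ∈ Set.range (coshPrimitive lam) := by
  by_contra hglue
  linarith [lt_of_mem_extremalSides hx hy hadd hs, lt_of_mem_extremalSides hx hy hadd hglue,
    (mem_closure_weights hx).2 s, hy.2 s]

theorem eventually_inward_mem_weights [Finite ι] (hx : x ∈ closure (T.weights lam z))
    (hy : y ∈ T.weights lam z) (hadd : ∀ h i, 0 < row x h (i + 1) + row x h (i + 2)) :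
    ∀ᶠ ε in 𝓝[>] (0 : ℝ), x + ε • T.inward lam x ∈ T.weights lam z := by
  have hray (h : ι) (i : Fin 3) := tendsto_ray (row x h) (row (T.inward lam x) h) i
  have hcone : ∀ᶠ ε in 𝓝[>] (0 : ℝ), ∀ h, row (x + ε • T.inward lam x) h ∈ weightCone lam := by
    refine eventually_all.2 fun h =>
      (eventually_all.2 fun i => ?_).and (eventually_all.2 fun i => ?_)
    · by_cases hs : (h, i) ∈ extremalSides lam x
      · have hglue : T.glue (h, i) ∉ extremalSides lam x :=
          not_not.2 (glue_mem_range hx hy hadd hs)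
        have hd : T.inward lam x (h, i) = -1 := by simp [inward, hs, hglue]
        filter_upwards [eventually_sub_mem_range (pos_of_mem_extremalSides hx hadd hs)
          ((bounds_of_mem_closure_weights hx h).1 i)] with ε hε
        simpa [row, hd, sub_eq_add_neg] using hε
      · exact (hray h i).eventually
          ((isOpen_range_coshPrimitive lam).mem_nhds (not_not.1 hs))
    · exact ((hray h (i + 1)).add (hray h (i + 2))).eventually (lt_mem_nhds (hadd h i))
  refine hcone.mono fun ε hε => ⟨hε, fun s => ?_⟩
  simp only [Pi.add_apply, Pi.smul_apply, smul_eq_mul]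
  linear_combination (mem_closure_weights hx).2 s + ε * T.inward_add_inward_glue x s

theorem eventually_sideSlope_lt (hx : x ∈ closure (T.weights lam z))
    (hray : ∀ᶠ τ in 𝓝[>] (0 : ℝ), x + τ • d ∈ T.weights lam z)
    (hadd : ∀ h i, 0 < row x h (i + 1) + row x h (i + 2))
    (hs : s ∈ extremalSides lam x) (ht : x t ∈ Set.range (coshPrimitive lam)) :
    ∀ᶠ τ in 𝓝[>] (0 : ℝ), sideSlope lam (x + τ • d) s < sideSlope lam (x + τ • d) t := by
  obtain ⟨hcl, -⟩ := bounds_of_mem_closure_weights hx s.1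
  have hbot := tendsto_sideLog_atBot (w := row x s.1) (d := row d s.1)
    (hray.mono fun τ hτ => hτ.1 s.1) hs (hcl s.2)
    (neg_lt_of_notMem_range hcl (hadd s.1) hs)
  obtain ⟨c, hlow⟩ := exists_eventually_le_sideLog (w := row x t.1) (d := row d t.1) ht
  filter_upwards [hbot.eventually_lt_atBot c, hlow, hray] with τ hlt hle hmem
  exact slope_strictMonoOn lam (sideLog_neg (coords_mem (hmem.1 s.1)) _)
    (sideLog_neg (coords_mem (hmem.1 t.1)) _) (hlt.trans_le hle)

theorem eventually_potentialSlope_inward_pos [Fintype ι] (hx : x ∈ closure (T.weights lam z))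
    (hy : y ∈ T.weights lam z) (hadd : ∀ h i, 0 < row x h (i + 1) + row x h (i + 2))
    (hne : (extremalSides lam x).Nonempty) : ∀ᶠ τ in 𝓝[>] (0 : ℝ),
      0 < potentialSlope lam (x + τ • T.inward lam x) (T.inward lam x) := by
  have hlt : ∀ᶠ τ in 𝓝[>] (0 : ℝ), ∀ s ∈ extremalSides lam x,
      sideSlope lam (x + τ • T.inward lam x) s <
        sideSlope lam (x + τ • T.inward lam x) (T.glue s) :=
    eventually_all.2 fun s => eventually_imp_distrib_left.2 fun hs => eventually_sideSlope_lt hx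
      (eventually_inward_mem_weights hx hy hadd) hadd hs (glue_mem_range hx hy hadd hs)
  obtain ⟨s, hs⟩ := hne
  filter_upwards [hlt] with τ hτ
  rw [potentialSlope_inward]
  refine Finset.sum_pos' (fun t _ => Set.indicator_nonneg (fun t ht => (sub_pos.2 (hτ t ht)).le) t)
    ⟨s, Finset.mem_univ s, ?_⟩
  rw [Set.indicator_of_mem hs]
  exact sub_pos.2 (hτ s hs)

theorem eventually_potentialSlope_pos_of_add_eq_zero [Fintype ι]
    (hx : x ∈ closure (T.weights lam z))
    (hray : ∀ τ ∈ Set.Ioc (0 : ℝ) 1, x + τ • d ∈ T.weights lam z) {h : ι} {k : Fin 3}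
    (hk : row x h (k + 1) + row x h (k + 2) = 0) :
    ∀ᶠ τ in 𝓝[>] (0 : ℝ), 0 < potentialSlope lam (x + τ • d) d := by
  classical
  have hunit : Set.Ioc (0 : ℝ) 1 ∈ 𝓝[>] 0 := Ioc_mem_nhdsGT zero_lt_one
  obtain ⟨hcl, hnn⟩ := bounds_of_mem_closure_weights hx h
  have htop := tendsto_sum_hexSlope (w := row x h) (d := row d h)
    (mem_of_superset hunit fun τ hτ => (hray τ hτ).1 h) hcl hnn hk
  -- The slopes of the other hexagons decrease in `τ`, so they are bounded below by those at `1`.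
  set C := ∑ g ∈ Finset.univ.erase h, ∑ i, hexSlope lam (row (x + (1 : ℝ) • d) g) i * row d g i
  filter_upwards [htop.eventually_gt_atTop (-C), hunit] with τ hgt hτ
  have hrest : C ≤ ∑ g ∈ Finset.univ.erase h, ∑ i, hexSlope lam (row (x + τ • d) g) i * row d g i :=
    Finset.sum_le_sum fun g _ => antitoneOn_sum_hexSlope (convex_Ioc 0 1)
      (fun τ hτ => (hray τ hτ).1 g) hτ (Set.right_mem_Ioc.2 one_pos) hτ.2
  rw [potentialSlope_eq, ← Finset.add_sum_erase _ _ (Finset.mem_univ h)]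
  exact neg_lt_iff_pos_add.1 ((neg_le_neg hrest).trans_lt hgt)

theorem exists_isMaxOn_potential [Fintype ι] (hne : (T.weights lam z).Nonempty) :
    ∃ x ∈ T.weights lam z, IsMaxOn (potential lam) (T.weights lam z) x := by
  have hcone : ∀ w ∈ T.weights lam z, ∀ h, row w h ∈ weightCone lam := fun _ hw => hw.1
  refine exists_isMaxOn_of_lt_at_boundary isCompact_closure_weights hne
    (concaveOn_potential convex_weights hcone).quasiconcaveOn
    ((continuousOn_potential lam).mono hcone) fun x hx hxP => ?_
  obtain ⟨y, hy⟩ := hne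
  by_cases hadd : ∀ h i, 0 < row x h (i + 1) + row x h (i + 2)
  · have hext : (extremalSides lam x).Nonempty := by
      by_contra! hempty
      have hall (s) : x s ∈ Set.range (coshPrimitive lam) :=
        not_not.1 (Set.eq_empty_iff_forall_notMem.1 hempty s)
      exact hxP ⟨fun h => ⟨fun i => hall (h, i), hadd h⟩, (mem_closure_weights hx).2⟩
    exact exists_potential_add_smul_sub_lt hcone (eventually_inward_mem_weights hx hy hadd)
      (eventually_potentialSlope_inward_pos hx hy hadd hext)
  · push Not at hadd
    obtain ⟨h, k, hk⟩ := hadd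
    have hray (τ : ℝ) (hτ : τ ∈ Set.Ioc (0 : ℝ) 1) := add_smul_sub_mem_weights hx hy hτ
    exact exists_potential_add_smul_sub_lt hcone
      (mem_of_superset (Ioc_mem_nhdsGT zero_lt_one) hray)
      (eventually_potentialSlope_pos_of_add_eq_zero hx hray
        (hk.antisymm ((bounds_of_mem_closure_weights hx h).2 k)))

theorem exists_sideLog_glue_eq [Finite ι] (hne : (T.weights lam z).Nonempty) :
    ∃ w ∈ T.weights lam z, ∀ s, sideLog (coords lam (row w (T.glue s).1)) (T.glue s).2 =
      sideLog (coords lam (row w s.1)) s.2 := by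
  classical
  have := Fintype.ofFinite ι
  obtain ⟨w, hw, hmax⟩ := exists_isMaxOn_potential hne
  refine ⟨w, hw, fun s => ?_⟩
  let d : ι × Fin 3 → ℝ := Pi.single (T.glue s) 1 - Pi.single s 1
  have hd (t : ι × Fin 3) : d t + d (T.glue t) = 0 := by
    have hglue : T.glue t = T.glue s ↔ t = s := T.glueEquiv.injective.eq_iff
    have hswap : T.glue t = s ↔ t = T.glue s := T.glueEquiv.eq_symm_apply.symm
    simp only [d, Pi.sub_apply, Pi.single_apply, hglue, hswap]
    ring
  have hcone : ∀ᶠ τ in 𝓝 (0 : ℝ), ∀ h, row (w + τ • d) h ∈ weightCone lam := by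
    refine eventually_all.2 fun h => ?_
    have hcont : Continuous fun τ : ℝ => row (w + τ • d) h :=
      (continuous_row h).comp (by fun_prop)
    exact hcont.continuousAt.eventually
      ((isOpen_weightCone lam).mem_nhds (by simpa only [zero_smul, add_zero] using hw.1 h))
  have hlocal : IsLocalMax (fun τ : ℝ => potential lam (w + τ • d)) 0 := by
    filter_upwards [hcone] with τ hτ
    rw [zero_smul, add_zero]
    refine hmax ⟨hτ, fun t => ?_⟩
    simp only [Pi.add_apply, Pi.smul_apply, smul_eq_mul]
    linear_combination hw.2 t + τ * hd t
  have hcrit := hlocal.hasDerivAt_eq_zero (hasDerivAt_potential hcone.self_of_nhds)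
  rw [zero_smul, add_zero, potentialSlope_single_sub, sub_eq_zero] at hcrit
  exact (slope_strictMonoOn lam).injOn (sideLog_neg (coords_mem (hw.1 _)) _)
    (sideLog_neg (coords_mem (hw.1 _)) _) hcrit

end IdealTriangulation

theorem redSide_eq (r : Fin 3 → ℝ) (i : Fin 3) : redSide r i =
    2 * Real.arsinh √(Real.exp (sideLog r i) / (1 - Real.exp (sideLog r i))) := by
  have hcosh : Real.cosh (r i + r (i + 1) + r (i + 2)) * Real.cosh (r i) ≠ 0 := by positivity
  obtain ⟨h11, h12, h21, h22⟩ := fin_three_add_add i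
  rw [sideLog, one_sub_exp_logRatio, exp_logRatio, div_div_div_cancel_right₀ hcosh, redSide,
    sinhArc, sinhArc, h11, h12, h21, h22]

namespace IdealTriangulation

variable {ι : Type*} {T : IdealTriangulation ι} {lam : ℝ} {z : T.Edge → ℝ}

theorem mem_range_Psi_of_weights_nonempty [Finite ι] (hne : (T.weights lam z).Nonempty) :
    z ∈ Set.range (T.Psi lam) := by
  obtain ⟨w, hw, hlog⟩ := exists_sideLog_glue_eq hne
  choose H hH hred using fun h => exists_hexagon (coords_mem (hw.1 h))
  let D : T.HyperbolicMetric := ⟨H, fun s => by rw [hred, hred, redSide_eq, redSide_eq, hlog]⟩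
  have hside (s : ι × Fin 3) : T.sideInvariant lam D s = w s := by
    change coshPrimitive lam ((H s.1).rCoord s.2) = w s
    rw [hH]
    exact coshPrimitive_coshInv ((hw.1 s.1).1 s.2)
  refine ⟨Quotient.mk _ D, funext fun e => Quotient.inductionOn e fun s => ?_⟩
  change T.sideInvariant lam D s + T.sideInvariant lam D (T.glue s) = z (T.edge s)
  rw [hside, hside, hw.2]

end IdealTriangulation

/-! ### The image of `Ψ` -/

theorem RightAngledHexagon.arcLength_pos (H : RightAngledHexagon) (i : Fin 3) :
    0 < H.arcLength i := by
  rw [arcLength, dist_pos]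
  intro heq
  have hangle := H.angle_q (i + 1)
  rw [(fin_three_add_add i).1, ← heq] at hangle
  simp only [orientedAngle, direction, sub_self, zero_div, div_zero, Complex.arg_zero] at hangle
  linarith [Real.pi_pos]

theorem RightAngledHexagon.rCoord_add_rCoord (H : RightAngledHexagon) (i : Fin 3) :
    H.rCoord (i + 1) + H.rCoord (i + 2) = H.arcLength i := by
  obtain ⟨h11, h12, h21, h22⟩ := fin_three_add_add i
  simp only [rCoord, h11, h12, h21, h22]
  ring

section ExtendedReals

variable {W : ℝ≥0∞} {lam y : ℝ}

theorem coe_lt_two_mul_iff :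
    (y : EReal) < ((2 * W : ℝ≥0∞) : EReal) ↔ (W ≠ ⊤ → y < 2 * W.toReal) := by
  rcases eq_or_ne W ⊤ with rfl | hW
  · simp
  · rw [← EReal.coe_ennreal_toReal (ENNReal.mul_ne_top ENNReal.ofNat_ne_top hW),
      EReal.coe_lt_coe_iff, ENNReal.toReal_mul, ENNReal.toReal_ofNat]
    exact (imp_iff_right hW).symm

theorem neg_two_mul_lt_coe_iff :
    -((2 * W : ℝ≥0∞) : EReal) < (y : EReal) ↔ (W ≠ ⊤ → -(2 * W.toReal) < y) := by
  rw [EReal.neg_lt_comm, ← EReal.coe_neg, coe_lt_two_mul_iff, neg_lt]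

theorem mem_range_coshPrimitive_iff_toReal : y ∈ Set.range (coshPrimitive lam) ↔
    (coshIntegral lam ≠ ⊤ → |y| < (coshIntegral lam).toReal) := by
  rw [mem_range_coshPrimitive]
  rcases eq_or_ne (coshIntegral lam) ⊤ with htop | htop
  · simp [htop]
  · rw [ENNReal.ofReal_lt_iff_lt_toReal (abs_nonneg y) htop]
    exact (imp_iff_right htop).symm

end ExtendedReals

namespace IdealTriangulation

variable {ι : Type*} {T : IdealTriangulation ι} {lam : ℝ} {z : T.Edge → ℝ}

theorem sideInvariant_mem_weights (lam : ℝ) (d : T.HyperbolicMetric) :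
    T.sideInvariant lam d ∈ T.weights lam (T.edgeInvariant lam d) := by
  refine ⟨fun h => ⟨fun i => ⟨_, rfl⟩, fun i => ?_⟩, fun s => rfl⟩
  change 0 < coshPrimitive lam ((d.hexagon h).rCoord (i + 1)) +
    coshPrimitive lam ((d.hexagon h).rCoord (i + 2))
  rw [← neg_lt_iff_pos_add, ← coshPrimitive_neg, (strictMono_coshPrimitive lam).lt_iff_lt,
    neg_lt_iff_pos_add, RightAngledHexagon.rCoord_add_rCoord]
  exact (d.hexagon h).arcLength_pos i

theorem mem_range_Psi_iff [Finite ι] :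
    z ∈ Set.range (T.Psi lam) ↔ (T.weights lam z).Nonempty := by
  refine ⟨?_, mem_range_Psi_of_weights_nonempty⟩
  rintro ⟨d, rfl⟩
  exact Quotient.inductionOn d fun d => ⟨_, sideInvariant_mem_weights lam d⟩

section WeightsNecessary

variable {w : ι × Fin 3 → ℝ}

theorem add_pos_of_follows (hw : w ∈ T.weights lam z) {s t : ι × Fin 3} (hst : T.Follows s t) :
    0 < w (T.glue s) + w t := by
  rcases t with ⟨h, j⟩
  obtain ⟨rfl, hne⟩ := hst
  exact add_pos_of_ne (hw.1 (T.glue s).1).2 fun hij => hne (Prod.ext rfl hij.symm)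

theorem add_glue_getLast_le_pathSum (hw : w ∈ T.weights lam z) (s : ι × Fin 3)
    (c : List (ι × Fin 3)) (hc : (s :: c).IsChain T.Follows) :
    w s + w (T.glue ((s :: c).getLast (List.cons_ne_nil s c))) ≤ T.pathSum z (s :: c) := by
  induction c generalizing s with
  | nil => simp [pathSum, hw.2]
  | cons t c ih =>
    rw [List.isChain_cons_cons] at hc
    have hsum : T.pathSum z (s :: t :: c) = z (T.edge s) + T.pathSum z (t :: c) := List.sum_cons
    rw [List.getLast_cons (List.cons_ne_nil t c), hsum]
    linarith [ih t hc.2, add_pos_of_follows hw hc.1, hw.2 s]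

theorem abs_lt_of_mem_weights (hw : w ∈ T.weights lam z) (hW : coshIntegral lam ≠ ⊤)
    (s : ι × Fin 3) : |w s| < (coshIntegral lam).toReal :=
  mem_range_coshPrimitive_iff_toReal.1 ((hw.1 s.1).1 s.2) hW

theorem edge_lt_of_mem_weights (hw : w ∈ T.weights lam z) (hW : coshIntegral lam ≠ ⊤)
    (e : T.Edge) : z e < 2 * (coshIntegral lam).toReal := by
  induction e using Quotient.inductionOn with | _ s
  change z (T.edge s) < _
  linarith [hw.2 s, (abs_lt.1 (abs_lt_of_mem_weights hw hW s)).2,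
    (abs_lt.1 (abs_lt_of_mem_weights hw hW (T.glue s))).2]

theorem lt_pathSum_of_mem_weights (hw : w ∈ T.weights lam z) (hW : coshIntegral lam ≠ ⊤)
    {c : List (ι × Fin 3)} (hc : T.IsEdgePath c) :
    -(2 * (coshIntegral lam).toReal) < T.pathSum z c := by
  obtain ⟨s, c, rfl⟩ := List.exists_cons_of_ne_nil hc.1
  linarith [add_glue_getLast_le_pathSum hw s c hc.2,
    (abs_lt.1 (abs_lt_of_mem_weights hw hW s)).1, (abs_lt.1 (abs_lt_of_mem_weights hw hW
      (T.glue ((s :: c).getLast (List.cons_ne_nil s c))))).1]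

theorem pathSum_pos_of_mem_weights (hw : w ∈ T.weights lam z) {c : List (ι × Fin 3)}
    (hc : T.IsEdgeCycle c) : 0 < T.pathSum z c := by
  obtain ⟨s, c, rfl⟩ := List.exists_cons_of_ne_nil hc.1.1
  obtain ⟨_, hclose⟩ := hc.2
  have hpos := add_pos_of_follows hw hclose
  rw [List.head_cons] at hpos
  linarith [add_glue_getLast_le_pathSum hw s c hc.1.2]

end WeightsNecessary

theorem isFundamental_of_nodup {c : List (ι × Fin 3)} (hc : c.Nodup) : T.IsFundamental c := by
  classical
  intro e
  induction e using Quotient.inductionOn with | _ s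
  change List.count (T.edge s) _ ≤ 2
  rw [List.count, List.countP_map, List.countP_eq_length_filter,
    ← List.toFinset_card_of_nodup (hc.filter _)]
  refine (Finset.card_le_card (t := {s, T.glue s}) fun t ht => ?_).trans Finset.card_le_two
  simp only [List.mem_toFinset, List.mem_filter, Function.comp_apply, beq_iff_eq] at ht
  have hst : s = t ∨ s = T.glue t := Quotient.exact ht.2
  rcases hst with rfl | rfl <;> simp [T.glue_glue]

theorem finite_edge [Finite ι] (T : IdealTriangulation ι) : Finite T.Edge := Quotient.finite _

theorem exists_bound [Finite ι] (T : IdealTriangulation ι) (z : T.Edge → ℝ) : ∃ B > 0,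
    (∀ e, z e < 2 * B) ∧ ∀ c : List (ι × Fin 3), c.Nodup → -(2 * B) < T.pathSum z c := by
  have := T.finite_edge
  have hlarge (x : ℝ) : ∀ᶠ B in atTop, x < 2 * B :=
    (tendsto_id.const_mul_atTop two_pos).eventually_gt_atTop x
  have hpath := (eventually_all_finite (finite_nodup_lists (ι × Fin 3))).2
    fun c _ => hlarge (-T.pathSum z c)
  obtain ⟨B, hpos, hedge, hpathB⟩ := ((eventually_gt_atTop 0).and
    ((eventually_all.2 fun e => hlarge (z e)).and hpath)).exists
  exact ⟨B, hpos, hedge, fun c hc => neg_lt.1 (hpathB c hc)⟩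

theorem weights_nonempty [Finite ι]
    (hedge : ∀ e, coshIntegral lam ≠ ⊤ → z e < 2 * (coshIntegral lam).toReal)
    (hpath : ∀ c, c.Nodup → T.IsEdgePath c → coshIntegral lam ≠ ⊤ →
      -(2 * (coshIntegral lam).toReal) < T.pathSum z c)
    (hcycle : ∀ c, c.Nodup → T.IsEdgeCycle c → 0 < T.pathSum z c) :
    (T.weights lam z).Nonempty := by
  have hbound : ∃ B > 0, (coshIntegral lam ≠ ⊤ → B ≤ (coshIntegral lam).toReal) ∧
      (∀ e, z e < 2 * B) ∧ ∀ c, c.Nodup → T.IsEdgePath c → -(2 * B) < T.pathSum z c := by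
    by_cases htop : coshIntegral lam = ⊤
    · obtain ⟨B, hB, hedgeB, hpathB⟩ := T.exists_bound z
      exact ⟨B, hB, fun h => absurd htop h, hedgeB, fun c hc _ => hpathB c hc⟩
    · exact ⟨_, ENNReal.toReal_pos (coshIntegral_pos lam).ne' htop, fun _ => le_rfl,
        fun e => hedge e htop, fun c hc hp => hpath c hc hp htop⟩
  obtain ⟨B, hB, hBW, hedgeB, hpathB⟩ := hbound
  obtain ⟨w, hw, habs, hadd⟩ := T.exists_sideWeights hB hedgeB hpathB hcycle
  exact ⟨w, fun h => ⟨fun i => mem_range_coshPrimitive_iff_toReal.2 fun htop =>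
    (habs (h, i)).trans_le (hBW htop), fun i => hadd _ _ rfl (by simp)⟩, hw⟩

theorem mem_range_Psi_iff_nodup [Finite ι] : z ∈ Set.range (T.Psi lam) ↔
    (∀ e, coshIntegral lam ≠ ⊤ → z e < 2 * (coshIntegral lam).toReal) ∧
    (∀ c, c.Nodup → T.IsEdgePath c → coshIntegral lam ≠ ⊤ →
      -(2 * (coshIntegral lam).toReal) < T.pathSum z c) ∧
    ∀ c, c.Nodup → T.IsEdgeCycle c → 0 < T.pathSum z c := by
  rw [mem_range_Psi_iff]
  constructor
  · rintro ⟨w, hw⟩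
    exact ⟨fun e htop => edge_lt_of_mem_weights hw htop e,
      fun c _ hc htop => lt_pathSum_of_mem_weights hw htop hc,
      fun c _ hc => pathSum_pos_of_mem_weights hw hc⟩
  · rintro ⟨hedge, hpath, hcycle⟩
    exact weights_nonempty hedge hpath hcycle

theorem range_Psi_eq [Finite ι] (T : IdealTriangulation ι) (lam : ℝ) : Set.range (T.Psi lam) =
    {z : T.Edge → ℝ |
      (∀ e : T.Edge, (z e : EReal) < ((2 * coshIntegral lam : ENNReal) : EReal)) ∧
      (∀ c : List (ι × Fin 3), T.IsEdgePath c → T.IsFundamental c →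
        -((2 * coshIntegral lam : ENNReal) : EReal) < (T.pathSum z c : EReal)) ∧
      (∀ c : List (ι × Fin 3), T.IsEdgeCycle c → T.IsFundamental c → 0 < T.pathSum z c)} := by
  ext z
  simp only [Set.mem_ofPred_eq, coe_lt_two_mul_iff, neg_two_mul_lt_coe_iff]
  constructor
  · rw [mem_range_Psi_iff]
    rintro ⟨w, hw⟩
    exact ⟨fun e htop => edge_lt_of_mem_weights hw htop e,
      fun c hc _ htop => lt_pathSum_of_mem_weights hw htop hc,
      fun c hc _ => pathSum_pos_of_mem_weights hw hc⟩
  · rintro ⟨hedge, hpath, hcycle⟩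
    exact mem_range_Psi_iff_nodup.2 ⟨hedge,
      fun c hn hc => hpath c hc (isFundamental_of_nodup hn),
      fun c hn hc => hcycle c hc (isFundamental_of_nodup hn)⟩

/-- The sum of the values on the edges of an edge path, as a linear functional: the left-hand side
of an inequality of the polytope. -/
def pathSumLinear (T : IdealTriangulation ι) (c : List (ι × Fin 3)) : (T.Edge → ℝ) →ₗ[ℝ] ℝ where
  toFun z := T.pathSum z c
  map_add' x y := by simp [pathSum, List.sum_map_add]
  map_smul' a x := by simp [pathSum, List.sum_map_mul_left]

end IdealTriangulation

theorem isOpenConvexPolytope_of_finite {E : Type*} [Finite E]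
    {A : Set (((E → ℝ) →ₗ[ℝ] ℝ) × ℝ)} (hA : A.Finite) :
    IsOpenConvexPolytope {z | ∀ a ∈ A, a.1 z < a.2} := by
  have hinter : {z : E → ℝ | ∀ a ∈ A, a.1 z < a.2} = ⋂ a ∈ A, {z | a.1 z < a.2} := by
    ext z; simp
  refine ⟨?_, ?_, A, hA, rfl⟩ <;> rw [hinter]
  · exact hA.isOpen_biInter fun a _ =>
      isOpen_lt a.1.continuous_of_finiteDimensional continuous_const
  · exact convex_iInter₂ fun a _ => convex_halfSpace_lt a.1.isLinear a.2

namespace IdealTriangulation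

variable {ι : Type*} {T : IdealTriangulation ι} {lam : ℝ} {z : T.Edge → ℝ}

theorem isOpenConvexPolytope_range_Psi [Finite ι] (T : IdealTriangulation ι) (lam : ℝ) :
    IsOpenConvexPolytope (Set.range (T.Psi lam)) := by
  have := T.finite_edge
  set W := coshIntegral lam
  let edges : Set (((T.Edge → ℝ) →ₗ[ℝ] ℝ) × ℝ) :=
    (fun e => (LinearMap.proj e, 2 * W.toReal)) '' {_e : T.Edge | W ≠ ⊤}
  let paths : Set (((T.Edge → ℝ) →ₗ[ℝ] ℝ) × ℝ) :=
    (fun c => (-T.pathSumLinear c, 2 * W.toReal)) '' {c | c.Nodup ∧ T.IsEdgePath c ∧ W ≠ ⊤}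
  let cycles : Set (((T.Edge → ℝ) →ₗ[ℝ] ℝ) × ℝ) :=
    (fun c => (-T.pathSumLinear c, 0)) '' {c | c.Nodup ∧ T.IsEdgeCycle c}
  have hlists := finite_nodup_lists (ι × Fin 3)
  have hfinite : (edges ∪ paths ∪ cycles).Finite :=
    (((Set.toFinite _).image _).union ((hlists.subset fun c hc => hc.1).image _)).union
      ((hlists.subset fun c hc => hc.1).image _)
  convert isOpenConvexPolytope_of_finite hfinite using 1
  ext z
  rw [mem_range_Psi_iff_nodup]
  simp only [Set.mem_ofPred_eq, edges, paths, cycles, Set.mem_union, or_imp, forall_and,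
    Set.forall_mem_image, and_imp, LinearMap.neg_apply, LinearMap.proj_apply, neg_lt, neg_zero,
    and_assoc]
  rfl

theorem weights_mono {lam₁ lam₂ : ℝ} (h : coshIntegral lam₁ ≤ coshIntegral lam₂) :
    T.weights lam₁ z ⊆ T.weights lam₂ z := fun _ hw =>
  ⟨fun k => ⟨fun i => mem_range_coshPrimitive.2
    ((mem_range_coshPrimitive.1 ((hw.1 k).1 i)).trans_le h), (hw.1 k).2⟩, hw.2⟩

theorem range_Psi_subset [Finite ι] {lam₁ lam₂ : ℝ} (h : coshIntegral lam₁ ≤ coshIntegral lam₂) :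
    Set.range (T.Psi lam₁) ⊆ Set.range (T.Psi lam₂) := fun _ hz =>
  mem_range_Psi_iff.2 ((mem_range_Psi_iff.1 hz).mono (weights_mono h))

theorem range_Psi_ssubset [Finite ι] [Nonempty ι] {lam₁ lam₂ : ℝ}
    (h : coshIntegral lam₁ < coshIntegral lam₂) :
    Set.range (T.Psi lam₁) ⊂ Set.range (T.Psi lam₂) := by
  refine ⟨range_Psi_subset h.le, fun hsub => ?_⟩
  set a := (coshIntegral lam₁).toReal with ha
  have hpos : 0 < a := ENNReal.toReal_pos (coshIntegral_pos lam₁).ne' h.ne_top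
  have hmem : (fun _ => 2 * a) ∈ Set.range (T.Psi lam₂) := by
    refine mem_range_Psi_iff.2 ⟨fun _ => a, fun k => ⟨fun i => mem_range_coshPrimitive.2 ?_,
      fun i => add_pos hpos hpos⟩, fun _ => (two_mul a).symm⟩
    rw [row, abs_of_pos hpos, ha, ENNReal.ofReal_toReal h.ne_top]
    exact h
  exact lt_irrefl (2 * a)
    ((mem_range_Psi_iff_nodup.1 (hsub hmem)).1 (T.edge (Classical.arbitrary ι, 0)) h.ne_top)

theorem exists_edge_pos [Finite ι] [Nonempty ι] (hz : z ∈ Set.range (T.Psi lam)) :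
    ∃ e, 0 < z e := by
  have := Fintype.ofFinite ι
  obtain ⟨w, hw⟩ := mem_range_Psi_iff.1 hz
  have hsum : 0 < ∑ s, z (T.edge s) := by
    rw [← two_mul_sum_weights hw.2]
    exact mul_pos two_pos
      (Finset.sum_pos (fun h _ => sum_pos_of_add_pos (hw.1 h).2) Finset.univ_nonempty)
  by_contra! hnonpos
  exact hsum.not_ge (Finset.sum_nonpos fun s _ => hnonpos (T.edge s))

theorem iInter_range_Psi_eq_empty [Finite ι] [Nonempty ι] (T : IdealTriangulation ι) :
    (⋂ lam ∈ Set.Iio (0 : ℝ), Set.range (T.Psi lam)) = ∅ := by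
  refine Set.eq_empty_iff_forall_notMem.2 fun z hz => ?_
  rw [Set.mem_iInter₂] at hz
  obtain ⟨e, he⟩ := exists_edge_pos (hz (-1) (Set.mem_Iio.2 neg_one_lt_zero))
  obtain ⟨lam, hlt, hlam⟩ := ((tendsto_coshIntegral_atBot.eventually_lt_const
    (ENNReal.ofReal_pos.2 (half_pos he))).and (eventually_lt_atBot 0)).exists
  have hupper := (mem_range_Psi_iff_nodup.1 (hz lam hlam)).1 e hlt.ne_top
  linarith [(ENNReal.lt_ofReal_iff_toReal_lt hlt.ne_top).1 hlt]

end IdealTriangulation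

end LuoCoord

end

theorem theorem1p3 {ι : Type*} [Finite ι] [Nonempty ι] (T : LuoCoord.IdealTriangulation ι) :
    (∀ lam : ℝ, Set.range (T.Psi lam) =
      {z : T.Edge → ℝ |
        (∀ e : T.Edge, (z e : EReal) < ((2 * LuoCoord.coshIntegral lam : ENNReal) : EReal)) ∧
        (∀ c : List (ι × Fin 3), T.IsEdgePath c → T.IsFundamental c →
          -((2 * LuoCoord.coshIntegral lam : ENNReal) : EReal) < (T.pathSum z c : EReal)) ∧
        (∀ c : List (ι × Fin 3), T.IsEdgeCycle c → T.IsFundamental c → 0 < T.pathSum z c)}) ∧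
    (∀ lam : ℝ, LuoCoord.IsOpenConvexPolytope (Set.range (T.Psi lam))) ∧
    (∀ lam₁ lam₂ lam₃ : ℝ, lam₁ < lam₂ → lam₂ < 0 → 0 < lam₃ →
      Set.range (T.Psi lam₁) ⊂ Set.range (T.Psi lam₂) ∧
      Set.range (T.Psi lam₂) ⊂ Set.range (T.Psi 0) ∧
      Set.range (T.Psi 0) = Set.range (T.Psi lam₃)) ∧
    (⋂ lam ∈ Set.Iio (0 : ℝ), Set.range (T.Psi lam)) = ∅ := by
  refine ⟨T.range_Psi_eq, T.isOpenConvexPolytope_range_Psi, fun lam₁ lam₂ lam₃ h12 h2 h3 => ?_,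
    T.iInter_range_Psi_eq_empty⟩
  have htop₀ : LuoCoord.coshIntegral 0 = ⊤ := LuoCoord.coshIntegral_of_nonneg le_rfl
  have htop₃ : LuoCoord.coshIntegral lam₃ = ⊤ := LuoCoord.coshIntegral_of_nonneg h3.le
  exact ⟨LuoCoord.IdealTriangulation.range_Psi_ssubset
      (LuoCoord.coshIntegral_strictMonoOn (h12.trans h2) h2 h12),
    LuoCoord.IdealTriangulation.range_Psi_ssubset (htop₀ ▸ LuoCoord.coshIntegral_lt_top h2),
    (LuoCoord.IdealTriangulation.range_Psi_subset (htop₀.trans htop₃.symm).le).antisymm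
      (LuoCoord.IdealTriangulation.range_Psi_subset (htop₃.trans htop₀.symm).le)⟩
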